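/- **Setting.** Let $X$ be a nonnegative, essentially bounded random variable (the loss) on a probability space, with c.d.f. $F_X$ and essential supremum $M$. Let $\mathfrak C$ be the set of (Borel) indemnity functions $I$ with $0\le I(x)\le x$ for all $x\in[0,M]$. Insurance is actuarially fair: the premium for $I$ is $\mathbb E[I(X)]$. For $I\in\mathfrak C$ the insurer's risk exposure function is $e_I(x)=I(x)-\mathbb E[I(X)]$, and his profit is $-e_I(X)$. An insured with initial wealth $w$ has final wealth $W_I(X)=w-X+I(X)-\mathbb E[I(X)]$. Given $\nu>0$, call $I\in\mathfrak C$ admissible if $\operatorname{var}[e_I(X)]\le\nu$. An admissible $I^*$ is optimal for $w$ if it maximizes $\mathbb E[U(W_I(X))]$ over all admissible $I$. The utility $U$ is three times differentiable on an open interval $D$, with $U'>0$ and $U''<0$ on $D$, and is strictly DAP: $-U'''/U''$ is strictly decreasing on $D$. Let $w_1<w_2$ be two initial wealth levels. $U$ is defined at the wealth levels that may occur, that is, $w_2\in D$ and $w_1-M-\mathbb E[I(X)]\in D$ for every admissible $I$. **Theorem.** Assume that $F_X$ is strictly increasing on $(0,M)$ and that $0<\nu<\operatorname{var}[X]$. Let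 $I_1^*$, $I_2^*$ be optimal for $w_1$, $w_2$. Each $I_i^*$ agrees, $X$-almost surely, with a function that is continuous on $[0,M]$. For $I_1^*,I_2^*$ taken in this continuous version, $e_{I_2^*}$ up-crosses $e_{I_1^*}$ twice on $[0,M]$: there are $0<z_0<z_1<M$ with $$e_{I_2^*}\le e_{I_1^*}\text{ on }[0,z_0),\qquad e_{I_2^*}\ge e_{I_1^*}\text{ on }[z_0,z_1),\qquad e_{I_2^*}\le e_{I_1^*}\text{ on }[z_1,M].$$ Moreover, the insurer's profit $-e_{I_2^*}(X)$ has less downside risk than $-e_{I_1^*}(X)$: writing $Z_i=-e_{I_i^*}(X)$, one has $\mathbb E[Z_2]=\mathbb E[Z_1]$, $\operatorname{var}[Z_2]=\operatorname{var}[Z_1]$ and $Z_2$ dominates $Z_1$ in third-degree stochastic dominance, i.e. in addition $$\int_{-\infty}^x\int_{-\infty}^y\bigl(F_{Z_1}(z)-F_{Z_2}(z)\bigr)\,dz\,dy\ge 0\quad\text{for all }x\in\mathbb R.$$ -/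

import Mathlib

open MeasureTheory ProbabilityTheory Set

noncomputable section

/-- `U` is a utility function on the open interval `D` of wealth levels: it is three times
differentiable on `D`, with `U' > 0` and `U'' < 0` there. (Values of `U` off `D` are irrelevant;
`D = univ` and `D = Ioi 0` are typical.) -/
structure IsUtility (D : Set ℝ) (U : ℝ → ℝ) : Prop where
  isOpen : IsOpen D
  ordConnected : D.OrdConnected
  diff_one : ∀ x ∈ D, DifferentiableAt ℝ U x
  diff_two : ∀ x ∈ D, DifferentiableAt ℝ (deriv U) x
  diff_three : ∀ x ∈ D, DifferentiableAt ℝ (deriv (deriv U)) x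
  deriv_pos : ∀ x ∈ D, 0 < deriv U x
  deriv_two_neg : ∀ x ∈ D, deriv (deriv U) x < 0

/-- The degree of absolute prudence `- U''' / U''`. -/
def absolutePrudence (U : ℝ → ℝ) (x : ℝ) : ℝ :=
  -(deriv (deriv (deriv U)) x / deriv (deriv U) x)

/-- Strictly decreasing absolute prudence on `D`. -/
def StrictlyDAP (D : Set ℝ) (U : ℝ → ℝ) : Prop :=
  StrictAntiOn (absolutePrudence U) D

/-- The cumulative distribution function of a random variable. -/
def cdfOf {Ω : Type*} [MeasurableSpace Ω] (μ : Measure Ω) (Z : Ω → ℝ) (z : ℝ) : ℝ :=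
  μ.real {ω | Z ω ≤ z}

/-- Expected value premium principle with safety loading `ρ`. -/
def premium {Ω : Type*} [MeasurableSpace Ω] (μ : Measure Ω) (ρ : ℝ) (Y : Ω → ℝ) : ℝ :=
  (1 + ρ) * ∫ ω, Y ω ∂μ

/-- The insurer's risk exposure function `e_I`. -/
def riskExposure {Ω : Type*} [MeasurableSpace Ω] (μ : Measure Ω) (X : Ω → ℝ) (ρ : ℝ)
    (I : ℝ → ℝ) (x : ℝ) : ℝ :=
  I x - premium μ ρ (fun ω => I (X ω))

/-- The insured's final wealth `W_I` as a function of the loss, for initial wealth `w`. -/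
def finalWealth {Ω : Type*} [MeasurableSpace Ω] (μ : Measure Ω) (X : Ω → ℝ) (ρ w : ℝ)
    (I : ℝ → ℝ) (x : ℝ) : ℝ :=
  w - x + I x - premium μ ρ (fun ω => I (X ω))

/-- The feasible set of indemnity functions for losses in `[0, M]` (principle of indemnity). -/
def IsIndemnity (M : ℝ) (I : ℝ → ℝ) : Prop :=
  Measurable I ∧ ∀ x ∈ Icc 0 M, 0 ≤ I x ∧ I x ≤ x

/-- Feasible indemnity functions for the loss `X` meeting the variance bound `ν`. -/
def IsAdmissible {Ω : Type*} [MeasurableSpace Ω] (μ : Measure Ω) (X : Ω → ℝ) (ρ ν : ℝ)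
    (I : ℝ → ℝ) : Prop :=
  IsIndemnity (essSup X μ) I ∧ variance (fun ω => riskExposure μ X ρ I (X ω)) μ ≤ ν

/-- `I` maximizes the insured's expected utility of final wealth among all admissible
indemnity functions. -/
def IsOptimalContract {Ω : Type*} [MeasurableSpace Ω] (μ : Measure Ω) (X : Ω → ℝ)
    (U : ℝ → ℝ) (w ρ ν : ℝ) (I : ℝ → ℝ) : Prop :=
  IsAdmissible μ X ρ ν I ∧ ∀ J : ℝ → ℝ, IsAdmissible μ X ρ ν J →
    ∫ ω, U (finalWealth μ X ρ w J (X ω)) ∂μ ≤ ∫ ω, U (finalWealth μ X ρ w I (X ω)) ∂μ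

/-- `J` is continuous on `[0, ess sup X]` and pays the same as `I` almost surely. -/
def IsContinuousVersion {Ω : Type*} [MeasurableSpace Ω] (μ : Measure Ω) (X : Ω → ℝ)
    (I J : ℝ → ℝ) : Prop :=
  ContinuousOn J (Icc 0 (essSup X μ)) ∧ ∀ᵐ ω ∂μ, J (X ω) = I (X ω)

/-- `g₁` up-crosses `g₂` twice on `[0, M]`, at interior points `z₀ < z₁`. -/
def UpCrossesTwice (M : ℝ) (g₁ g₂ : ℝ → ℝ) : Prop :=
  ∃ z₀ z₁ : ℝ, 0 < z₀ ∧ z₀ < z₁ ∧ z₁ < M ∧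
    (∀ x, 0 ≤ x → x < z₀ → g₁ x ≤ g₂ x) ∧
    (∀ x, z₀ ≤ x → x < z₁ → g₂ x ≤ g₁ x) ∧
    (∀ x, z₁ ≤ x → x ≤ M → g₁ x ≤ g₂ x)

/-- `Z₁` dominates `Z₂` in third-degree stochastic dominance. The integrals start at `-∞`, as
the random variables may take negative values; for nonnegative ones they start at `0`. -/
def DominatesTSD {Ω : Type*} [MeasurableSpace Ω] (μ : Measure Ω) (Z₁ Z₂ : Ω → ℝ) : Prop :=
  ∫ ω, Z₂ ω ∂μ ≤ ∫ ω, Z₁ ω ∂μ ∧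
    ∀ x : ℝ, 0 ≤ ∫ y in Iic x, ∫ z in Iic y, (cdfOf μ Z₂ z - cdfOf μ Z₁ z)

/-- `Z₁` has less downside risk than `Z₂`: equal means and variances, and dominance in TSD. -/
def LessDownsideRisk {Ω : Type*} [MeasurableSpace Ω] (μ : Measure Ω) (Z₁ Z₂ : Ω → ℝ) : Prop :=
  DominatesTSD μ Z₁ Z₂ ∧ ∫ ω, Z₁ ω ∂μ = ∫ ω, Z₂ ω ∂μ ∧ variance Z₁ μ = variance Z₂ μ

end

/-!
Why the theorem holds. Both optimal contracts solve concave problems with one convex constraint, so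
a Lagrange multiplier `l` exists (`exists_multiplier`), and the gradient
`G = U'(W_I) - E U'(W_I) - l e_I` of the Lagrangian is nonpositive in every feasible direction.
Hence `I(X) = X` where `G > 0` and `I(X) = 0` where `G < 0`. As the premium is fair, `E G = 0`; as
marginal utility is smaller under full indemnity than under none, `G` cannot take both signs.
Therefore `G = 0` almost surely. The multiplier is positive, since otherwise final wealth would be
constant and `I(X)` would have the variance of `X`; so the variance bound is tight
(`IsOptimalContract.exists_stationary`).

The equation `U'(w - x + e(x)) = c + l e(x)` makes final wealth a contraction of `x`, which yields
the continuous version (`exists_isContinuousVersion`), and it shows that `e` increases while wealth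
decreases. Insert `e₁` into the equation of `e₂`: with `δ = w₂ - w₁` and `r = l₂ / l₁`, the sign of
`e₂ - e₁` at `x` is the sign of `U'(t + δ) - r U'(t) + const` at the wealth level `t` that belongs
to `e₁`. Strictly decreasing absolute prudence says that `U''(t + δ) / U''(t)` increases strictly,
so this function of `t` first increases and then decreases
(`IsUtility.not_decrease_increase`). Hence `{e₂ ≥ e₁}` is an interval. Equal means and equal
second moments say that `e₂ - e₁` is orthogonal to `1` and to the increasing function `e₁ + e₂`,
which excludes fewer than two changes of sign (`exists_two_crossings`).

The double integral of the distribution function of `Z` up to `x` is `E ((x - Z)⁺)² / 2`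
(`dominatesTSD_of_lower_partial_moments`). For `Z = -e(X)` these moments are compared after
subtracting the quadratic whose derivative is the chord of the convex derivative of `((x + t)⁺)²`
between the two crossing values; quadratics have the same mean under both exposures
(`integral_max_sq_le_of_two_crossings`).
-/

/-! ### Utility functions with decreasing absolute prudence -/

namespace IsUtility

variable {D : Set ℝ} {U : ℝ → ℝ}

theorem strictAntiOn_deriv (hU : IsUtility D U) : StrictAntiOn (deriv U) D := by
  refine strictAntiOn_of_deriv_neg hU.ordConnected.convex
    (fun x hx => (hU.diff_two x hx).continuousAt.continuousWithinAt) fun x hx => ?_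
  rw [hU.isOpen.interior_eq] at hx
  exact hU.deriv_two_neg x hx

theorem continuousOn (hU : IsUtility D U) : ContinuousOn U D :=
  fun x hx => (hU.diff_one x hx).continuousAt.continuousWithinAt

theorem continuousOn_deriv (hU : IsUtility D U) : ContinuousOn (deriv U) D :=
  fun x hx => (hU.diff_two x hx).continuousAt.continuousWithinAt

/-- Concavity of the utility, as the tangent inequality with the slope taken at the end point. -/
theorem deriv_mul_sub_le (hU : IsUtility D U) {x y : ℝ} (hx : x ∈ D) (hy : y ∈ D) :
    deriv U y * (y - x) ≤ U y - U x := by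
  rcases lt_trichotomy x y with h | h | h
  · obtain ⟨ξ, hξ, e⟩ := exists_deriv_eq_slope U h
      (hU.continuousOn.mono (hU.ordConnected.out hx hy))
      (fun z hz => (hU.diff_one z
        (hU.ordConnected.out hx hy (Ioo_subset_Icc_self hz))).differentiableWithinAt)
    have hξD := hU.ordConnected.out hx hy (Ioo_subset_Icc_self hξ)
    have h1 := hU.strictAntiOn_deriv hξD hy hξ.2
    rw [eq_div_iff (by linarith)] at e
    nlinarith
  · simp [h]
  · obtain ⟨ξ, hξ, e⟩ := exists_deriv_eq_slope U h
      (hU.continuousOn.mono (hU.ordConnected.out hy hx))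
      (fun z hz => (hU.diff_one z
        (hU.ordConnected.out hy hx (Ioo_subset_Icc_self hz))).differentiableWithinAt)
    have hξD := hU.ordConnected.out hy hx (Ioo_subset_Icc_self hξ)
    have h1 := hU.strictAntiOn_deriv hy hξD hξ.1
    rw [eq_div_iff (by linarith)] at e
    nlinarith

/-- Under decreasing absolute prudence `log (-U'')` is strictly convex, so the ratio of the values
of `U''` at two points a fixed distance apart increases strictly. -/
theorem strictMonoOn_deriv_two_ratio (hU : IsUtility D U) (hDAP : StrictlyDAP D U) {δ : ℝ}
    (hδ : 0 < δ) {a b : ℝ} (ha : a ∈ D) (hb : b + δ ∈ D) :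
    StrictMonoOn (fun t => deriv (deriv U) (t + δ) / deriv (deriv U) t) (Icc a b) := by
  have hD : ∀ t ∈ Icc a b, t ∈ D ∧ t + δ ∈ D := fun t ht =>
    ⟨hU.ordConnected.out ha hb ⟨ht.1, by linarith [ht.2]⟩,
      hU.ordConnected.out ha hb ⟨by linarith [ht.1], by linarith [ht.2]⟩⟩
  have hder : ∀ t ∈ Icc a b, HasDerivAt (fun t => deriv (deriv U) (t + δ) / deriv (deriv U) t)
      ((deriv (deriv (deriv U)) (t + δ) * deriv (deriv U) t
        - deriv (deriv U) (t + δ) * deriv (deriv (deriv U)) t) / deriv (deriv U) t ^ 2) t := by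
    intro t ht
    have h1 := (hU.diff_three _ (hD t ht).2).hasDerivAt.comp_add_const t δ
    exact h1.div (hU.diff_three _ (hD t ht).1).hasDerivAt (hU.deriv_two_neg _ (hD t ht).1).ne
  refine strictMonoOn_of_deriv_pos (convex_Icc a b)
    (fun t ht => (hder t ht).continuousAt.continuousWithinAt) fun t ht => ?_
  have ht := interior_subset ht
  rw [(hder t ht).deriv]
  have n1 := hU.deriv_two_neg _ (hD t ht).1
  have n2 := hU.deriv_two_neg _ (hD t ht).2
  have hp := hDAP (hD t ht).1 (hD t ht).2 (by linarith)
  simp only [absolutePrudence, neg_lt_neg_iff] at hp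
  refine div_pos ?_ (sq_pos_of_neg n1)
  rw [div_lt_iff_of_neg n1, div_mul_eq_mul_div, div_lt_iff_of_neg n2] at hp
  linarith

/-- Under decreasing absolute prudence the function `t ↦ U'(t + δ) - r U'(t)` cannot decrease and
later increase, even weakly: the sign of its derivative is that of
`r - U''(t + δ) / U''(t)`, which changes at most once, from plus to minus. -/
theorem not_decrease_increase (hU : IsUtility D U) (hDAP : StrictlyDAP D U) {δ : ℝ}
    (hδ : 0 < δ) (r : ℝ) {a b c : ℝ} (ha : a ∈ D) (hc : c + δ ∈ D) (hab : a < b) (hbc : b < c)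
    (h₁ : deriv U (b + δ) - r * deriv U b ≤ deriv U (a + δ) - r * deriv U a)
    (h₂ : deriv U (b + δ) - r * deriv U b ≤ deriv U (c + δ) - r * deriv U c) : False := by
  have hD : ∀ t ∈ Icc a c, t ∈ D ∧ t + δ ∈ D := fun t ht =>
    ⟨hU.ordConnected.out ha hc ⟨ht.1, by linarith [ht.2]⟩,
      hU.ordConnected.out ha hc ⟨by linarith [ht.1], by linarith [ht.2]⟩⟩
  have hder : ∀ t ∈ Icc a c, HasDerivAt (fun t => deriv U (t + δ) - r * deriv U t)
      (deriv (deriv U) (t + δ) - r * deriv (deriv U) t) t := fun t ht =>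
    ((hU.diff_two _ (hD t ht).2).hasDerivAt.comp_add_const t δ).sub
      ((hU.diff_two _ (hD t ht).1).hasDerivAt.const_mul r)
  have s1 : Icc a b ⊆ Icc a c := Icc_subset_Icc_right hbc.le
  have s2 : Icc b c ⊆ Icc a c := Icc_subset_Icc_left hab.le
  obtain ⟨ξ, hξ, e1⟩ := exists_hasDerivAt_eq_slope _ _ hab
    (fun t ht => (hder t (s1 ht)).continuousAt.continuousWithinAt)
    (fun t ht => hder t (s1 (Ioo_subset_Icc_self ht)))
  obtain ⟨η, hη, e2⟩ := exists_hasDerivAt_eq_slope _ _ hbc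
    (fun t ht => (hder t (s2 ht)).continuousAt.continuousWithinAt)
    (fun t ht => hder t (s2 (Ioo_subset_Icc_self ht)))
  have hξ' := s1 (Ioo_subset_Icc_self hξ)
  have hη' := s2 (Ioo_subset_Icc_self hη)
  have i1 : deriv (deriv U) (ξ + δ) - r * deriv (deriv U) ξ ≤ 0 := by
    rw [e1]; exact div_nonpos_of_nonpos_of_nonneg (by linarith) (by linarith)
  have i2 : 0 ≤ deriv (deriv U) (η + δ) - r * deriv (deriv U) η := by
    rw [e2]; exact div_nonneg (by linarith) (by linarith)
  have := hU.strictMonoOn_deriv_two_ratio hDAP hδ ha hc hξ' hη' (hξ.2.trans hη.1)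
  have j1 : r ≤ deriv (deriv U) (ξ + δ) / deriv (deriv U) ξ := by
    rw [le_div_iff_of_neg (hU.deriv_two_neg _ (hD ξ hξ').1)]; linarith
  have j2 : deriv (deriv U) (η + δ) / deriv (deriv U) η ≤ r := by
    rw [div_le_iff_of_neg (hU.deriv_two_neg _ (hD η hη').1)]; linarith
  simp only at this
  linarith

end IsUtility

/-! ### A Lagrange multiplier in the plane -/

/-- A Lagrange multiplier in the plane: if the convex set `K` of pairs (gain, increase of the
constraint) contains no pair with a positive gain and a decrease of the constraint, and the
constraint can be decreased, then the gain is at most a multiple of the increase. -/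
theorem exists_multiplier {K : Set (ℝ × ℝ)} (hK : Convex ℝ K) (h0 : (0, 0) ∈ K)
    (hneg : ∃ p ∈ K, p.2 < 0) (hno : ∀ p ∈ K, p.2 < 0 → p.1 ≤ 0) :
    ∃ l : ℝ, 0 ≤ l ∧ ∀ p ∈ K, p.1 ≤ l * p.2 := by
  obtain ⟨f, u, hf, hu⟩ := geometric_hahn_banach_open
    ((convex_Ioi (0 : ℝ)).prod (convex_Iio (0 : ℝ))) (isOpen_Ioi.prod isOpen_Iio) hK
    (Set.disjoint_left.2 fun p hp hpK => absurd (hno p hpK hp.2) (not_le.2 hp.1))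
  set p := f (1, 0) with hp
  set q := f (0, 1) with hq
  have hfe : ∀ x : ℝ × ℝ, f x = x.1 * p + x.2 * q := by
    intro x
    have : x = x.1 • ((1 : ℝ), (0 : ℝ)) + x.2 • ((0 : ℝ), (1 : ℝ)) := by ext <;> simp
    rw [hp, hq, ← smul_eq_mul, ← smul_eq_mul, ← map_smul, ← map_smul, ← map_add, ← this]
  have hu0 : u ≤ 0 := by simpa [hfe] using hu _ h0
  have key : ∀ a b : ℝ, 0 < a → 0 < b → a * p - b * q < u := by
    intro a b ha hb
    have := hf (a, -b) ⟨ha, by simpa using hb⟩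
    rw [hfe] at this
    simpa [sub_eq_add_neg] using this
  have hp0 : p ≤ 0 := by
    by_contra! h
    have := key ((|q| + 1) / p) 1 (by positivity) one_pos
    rw [div_mul_cancel₀ _ h.ne'] at this
    linarith [le_abs_self q]
  have hq0 : 0 ≤ q := by
    by_contra! h
    have := key 1 ((|p| + 1) / -q) one_pos (div_pos (by positivity) (by linarith))
    rw [div_mul_eq_mul_div, mul_comm, mul_div_assoc, div_neg, div_self h.ne] at this
    linarith [neg_abs_le p]
  have hKu : ∀ x ∈ K, 0 ≤ x.1 * p + x.2 * q := by
    intro x hx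
    have h1 := hu x hx
    rw [hfe] at h1
    -- `u ≥ 0`, since `f` is arbitrarily small on the open quadrant near the origin
    have h2 : 0 ≤ u := by
      by_contra! h
      set e := -u / (2 * (|p| + |q| + 1))
      have he : 0 < e := div_pos (by linarith) (by positivity)
      have h3 := key e e he he
      have h4 : e * (|p| + |q| + 1) = -u / 2 := by
        simp only [e]; field_simp
      nlinarith [neg_abs_le p, le_abs_self q, abs_nonneg p, abs_nonneg q]
    linarith
  have hp1 : p < 0 := by
    refine lt_of_le_of_ne hp0 fun h => ?_
    obtain ⟨x, hx, hx2⟩ := hneg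
    have h1 := hKu x hx
    have h2 := key 1 1 one_pos one_pos
    rw [h] at h1 h2
    nlinarith
  refine ⟨q / -p, div_nonneg hq0 (by linarith), fun x hx => ?_⟩
  rw [div_mul_eq_mul_div, le_div_iff₀ (by linarith)]
  linarith [hKu x hx]

/-! ### The squared positive part -/

theorem hasDerivAt_max_zero_sq (a t : ℝ) :
    HasDerivAt (fun t => max (a + t) 0 ^ 2) (2 * max (a + t) 0) t := by
  rcases lt_trichotomy (a + t) 0 with h | h | h
  · rw [max_eq_right h.le, mul_zero]
    refine (hasDerivAt_const t (0 : ℝ)).congr_of_eventuallyEq ?_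
    filter_upwards [(continuous_const_add a).continuousAt.eventually_lt continuousAt_const h]
      with y hy
    simp [max_eq_right hy.le]
  · rw [h, max_self, mul_zero, hasDerivAt_iff_isLittleO]
    refine Asymptotics.IsBigO.trans_isLittleO (g := fun y => (y - t) ^ 2) ?_ ?_
    · refine Asymptotics.IsBigO.of_bound 1 (Filter.Eventually.of_forall fun y => ?_)
      have hy : a + y = y - t := by linarith
      rcases le_total 0 (y - t) with h' | h' <;> simp [h, hy, h', sq_nonneg]
    · have h1 : (fun y => y - t) =o[nhds t] (fun _ => (1 : ℝ)) := by
        rw [Asymptotics.isLittleO_one_iff]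
        have : ContinuousAt (fun y : ℝ => y - t) t := by fun_prop
        simpa [ContinuousAt] using this
      simpa [pow_two] using h1.mul_isBigO (Asymptotics.isBigO_refl (fun y => y - t) (nhds t))
  · rw [max_eq_left h.le]
    have h1 : HasDerivAt (fun t => (a + t) ^ 2) (2 * (a + t)) t := by
      convert! ((hasDerivAt_id t).const_add a).pow 2 using 1
      simp
    refine h1.congr_of_eventuallyEq ?_
    filter_upwards [continuousAt_const.eventually_lt (continuous_const_add a).continuousAt h]
      with y hy
    simp [max_eq_left hy.le]

/-- The derivative of `((a + t)⁺)²` is convex; subtracting the quadratic whose derivative is the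
chord over `[u, v]` leaves a function that increases outside `[u, v]` and decreases inside. -/
theorem exists_quadratic_sub_monotone (a : ℝ) {u v : ℝ} (huv : u < v) : ∃ α β : ℝ,
    MonotoneOn (fun t => max (a + t) 0 ^ 2 - (α * t + β * t ^ 2)) (Iic u) ∧
    AntitoneOn (fun t => max (a + t) 0 ^ 2 - (α * t + β * t ^ 2)) (Icc u v) ∧
    MonotoneOn (fun t => max (a + t) 0 ^ 2 - (α * t + β * t ^ 2)) (Ici v) := by
  set p : ℝ → ℝ := fun t => 2 * max (a + t) 0 with hp
  have hconv : ConvexOn ℝ univ p := by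
    have h1 : ConvexOn ℝ univ (fun t : ℝ => a + t) :=
      (convexOn_const a convex_univ).add (convexOn_id convex_univ)
    have h2 := (h1.sup (convexOn_const (0 : ℝ) convex_univ)).smul (zero_le_two (α := ℝ))
    exact h2
  set s := (p v - p u) / (v - u) with hs
  have hsv : s * (v - u) = p v - p u := div_mul_cancel₀ _ (by linarith)
  have hder : ∀ t, HasDerivAt
      (fun t => max (a + t) 0 ^ 2 - ((p u - s * u) * t + s / 2 * t ^ 2))
      (p t - (p u + s * (t - u))) t := by
    intro t
    have h1 : HasDerivAt (fun t : ℝ => (p u - s * u) * t + s / 2 * t ^ 2)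
        ((p u - s * u) * 1 + s / 2 * (2 * t)) t := by
      convert! ((hasDerivAt_id t).const_mul (p u - s * u)).add
        (((hasDerivAt_id t).pow 2).const_mul (s / 2)) using 1
      simp
    convert! (hasDerivAt_max_zero_sq a t).sub h1 using 1
    ring
  refine ⟨p u - s * u, s / 2, ?_, ?_, ?_⟩
  · refine monotoneOn_of_hasDerivWithinAt_nonneg (convex_Iic u)
      (fun t _ => (hder t).continuousAt.continuousWithinAt)
      (fun t _ => (hder t).hasDerivWithinAt) fun t ht => ?_
    rw [interior_Iic] at ht
    have h := hconv.slope_mono_adjacent (mem_univ t) (mem_univ v) ht huv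
    rw [← hs, div_le_iff₀ (by linarith [mem_Iio.1 ht])] at h
    linarith
  · refine antitoneOn_of_hasDerivWithinAt_nonpos (convex_Icc u v)
      (fun t _ => (hder t).continuousAt.continuousWithinAt)
      (fun t _ => (hder t).hasDerivWithinAt) fun t ht => ?_
    rw [interior_Icc] at ht
    have h := hconv.secant_mono (mem_univ u) (mem_univ t) (mem_univ v) ht.1.ne'
      huv.ne' ht.2.le
    rw [← hs, div_le_iff₀ (by linarith [ht.1])] at h
    linarith
  · refine monotoneOn_of_hasDerivWithinAt_nonneg (convex_Ici v)
      (fun t _ => (hder t).continuousAt.continuousWithinAt)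
      (fun t _ => (hder t).hasDerivWithinAt) fun t ht => ?_
    rw [interior_Ici] at ht
    have h := hconv.secant_mono (mem_univ u) (mem_univ v) (mem_univ t) huv.ne'
      (huv.trans ht).ne' (le_of_lt ht)
    rw [← hs, le_div_iff₀ (by linarith [mem_Ioi.1 ht])] at h
    linarith

/-! ### Indemnity functions and the first-order condition -/

section Indemnity

variable {Ω : Type*} [MeasurableSpace Ω] {μ : Measure Ω}

theorem integrable_comp_of_continuousOn [IsProbabilityMeasure μ] {f : ℝ → ℝ} {Y : Ω → ℝ} {a b : ℝ}
    (hf : ContinuousOn f (Icc a b)) (hY : AEMeasurable Y μ) (h : ∀ᵐ ω ∂μ, Y ω ∈ Icc a b) :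
    Integrable (fun ω => f (Y ω)) μ := by
  classical
  have hm : Measurable ((Icc a b).piecewise f 0) :=
    hf.measurable_piecewise continuousOn_const measurableSet_Icc
  have he : (fun ω => (Icc a b).piecewise f 0 (Y ω)) =ᵐ[μ] fun ω => f (Y ω) := by
    filter_upwards [h] with ω hω
    exact piecewise_eq_of_mem _ _ _ hω
  obtain ⟨C, hC⟩ := isCompact_Icc.exists_bound_of_continuousOn hf
  refine Integrable.of_bound ((hm.comp_aemeasurable hY).congr he).aestronglyMeasurable C ?_
  filter_upwards [h] with ω hω using hC _ hω

@[simp]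
theorem premium_zero (Y : Ω → ℝ) : premium μ 0 Y = ∫ ω, Y ω ∂μ := by
  simp [premium]

theorem ae_mem_Icc_essSup {X : Ω → ℝ} (hX0 : ∀ᵐ ω ∂μ, 0 ≤ X ω)
    (hXb : ∃ C : ℝ, ∀ᵐ ω ∂μ, X ω ≤ C) : ∀ᵐ ω ∂μ, X ω ∈ Icc 0 (essSup X μ) := by
  obtain ⟨C, hC⟩ := hXb
  filter_upwards [hX0, ae_le_essSup (f := X) (μ := μ) ⟨C, by simpa using hC⟩] with ω h1 h2
  exact ⟨h1, h2⟩

namespace IsIndemnity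

variable {M : ℝ} {X : Ω → ℝ} {I J : ℝ → ℝ}

theorem measurable_comp (hI : IsIndemnity M I) (hX : Measurable X) :
    Measurable fun ω => I (X ω) := hI.1.comp hX

theorem ae_mem_Icc (hI : IsIndemnity M I) (hXM : ∀ᵐ ω ∂μ, X ω ∈ Icc 0 M) :
    ∀ᵐ ω ∂μ, I (X ω) ∈ Icc 0 M := by
  filter_upwards [hXM] with ω h
  exact ⟨(hI.2 _ h).1, (hI.2 _ h).2.trans h.2⟩

theorem memLp [IsProbabilityMeasure μ] (hI : IsIndemnity M I) (hX : Measurable X)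
    (hXM : ∀ᵐ ω ∂μ, X ω ∈ Icc 0 M) : MemLp (fun ω => I (X ω)) 2 μ :=
  memLp_of_bounded (hI.ae_mem_Icc hXM) (hI.measurable_comp hX).aestronglyMeasurable 2

theorem integrable [IsProbabilityMeasure μ] (hI : IsIndemnity M I) (hX : Measurable X)
    (hXM : ∀ᵐ ω ∂μ, X ω ∈ Icc 0 M) : Integrable (fun ω => I (X ω)) μ :=
  (hI.memLp hX hXM).integrable one_le_two

theorem integral_nonneg (hI : IsIndemnity M I) (hXM : ∀ᵐ ω ∂μ, X ω ∈ Icc 0 M) :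
    0 ≤ ∫ ω, I (X ω) ∂μ :=
  integral_nonneg_of_ae ((hI.ae_mem_Icc hXM).mono fun _ h => h.1)

theorem convexComb (hI : IsIndemnity M I) (hJ : IsIndemnity M J) {a b : ℝ} (ha : 0 ≤ a)
    (hb : 0 ≤ b) (hab : a + b = 1) : IsIndemnity M (fun x => a * I x + b * J x) := by
  refine ⟨(hI.1.const_mul a).add (hJ.1.const_mul b), fun x hx => ?_⟩
  obtain ⟨h1, h2⟩ := hI.2 x hx
  obtain ⟨h3, h4⟩ := hJ.2 x hx
  have := mul_nonneg ha h1
  have := mul_nonneg hb h3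
  refine ⟨by positivity, ?_⟩
  calc a * I x + b * J x ≤ a * x + b * x := by gcongr
    _ = x := by rw [← add_mul, hab, one_mul]

theorem zero : IsIndemnity M (fun _ => 0) := ⟨measurable_const, fun _ hx => ⟨le_rfl, hx.1⟩⟩

end IsIndemnity

theorem variance_riskExposure [IsProbabilityMeasure μ] {X : Ω → ℝ} {I : ℝ → ℝ}
    (h : Measurable fun ω => I (X ω)) (ρ : ℝ) :
    variance (fun ω => riskExposure μ X ρ I (X ω)) μ = variance (fun ω => I (X ω)) μ :=
  variance_sub_const h.aestronglyMeasurable _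

/-- The domain `D` contains the initial wealth `w` and, for every admissible contract, the wealth
`w` less the largest loss and the fair premium. For an order-connected `D` these bounds keep the
final wealth of admissible contracts in `D`. -/
def WealthInDomain (μ : Measure Ω) (X : Ω → ℝ) (ν : ℝ) (D : Set ℝ) (w : ℝ) : Prop :=
  w ∈ D ∧ ∀ I : ℝ → ℝ, IsAdmissible μ X 0 ν I → w - essSup X μ - ∫ ω, I (X ω) ∂μ ∈ D

section FirstOrder

variable {X : Ω → ℝ} {ν w : ℝ} {D : Set ℝ} {U I J : ℝ → ℝ}

theorem finalWealth_mem_Icc (hI : IsIndemnity (essSup X μ) I)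
    (hXM : ∀ᵐ ω ∂μ, X ω ∈ Icc 0 (essSup X μ)) {x : ℝ} (hx : x ∈ Icc 0 (essSup X μ)) :
    finalWealth μ X 0 w I x ∈ Icc (w - essSup X μ - ∫ ω, I (X ω) ∂μ) w := by
  have := hI.integral_nonneg (X := X) hXM
  have := hI.2 x hx
  simp only [finalWealth, premium_zero]
  constructor <;> linarith [hx.1, hx.2]

theorem measurable_finalWealth (hI : IsIndemnity (essSup X μ) I) (hX : Measurable X) :
    Measurable fun ω => finalWealth μ X 0 w I (X ω) :=
  ((hX.const_sub w).add (hI.measurable_comp hX)).sub_const _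

/-- Moving from the optimal contract `I` towards a feasible `J` that does not increase the
variance to first order (or from an `I` with slack variance) does not raise expected utility to
first order. -/
theorem IsOptimalContract.first_order [IsProbabilityMeasure μ] (hX : Measurable X)
    (hXM : ∀ᵐ ω ∂μ, X ω ∈ Icc 0 (essSup X μ)) (hU : IsUtility D U)
    (hw : WealthInDomain μ X ν D w) (hI : IsOptimalContract μ X U w 0 ν I)
    (hJ : IsIndemnity (essSup X μ) J)
    (hb : variance (fun ω => I (X ω)) μ < ν ∨
      cov[fun ω => I (X ω), fun ω => J (X ω) - I (X ω); μ] < 0) :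
    ∫ ω, deriv U (finalWealth μ X 0 w I (X ω)) *
      (J (X ω) - I (X ω) - (∫ ω, J (X ω) ∂μ - ∫ ω, I (X ω) ∂μ)) ∂μ ≤ 0 := by
  set M := essSup X μ with hM
  obtain ⟨⟨hI0, hIν⟩, hopt⟩ := hI
  rw [variance_riskExposure (hI0.measurable_comp hX)] at hIν
  set H : Ω → ℝ := fun ω => J (X ω) - I (X ω) with hH
  set K : Ω → ℝ := fun ω => H ω - (∫ ω, J (X ω) ∂μ - ∫ ω, I (X ω) ∂μ) with hK
  have hHm : Measurable H := (hJ.measurable_comp hX).sub (hI0.measurable_comp hX)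
  have hKm : Measurable K := hHm.sub_const _
  have hHL : MemLp H 2 μ := (hJ.memLp hX hXM).sub (hI0.memLp hX hXM)
  have hKint : Integrable K μ := (hHL.integrable one_le_two).sub (integrable_const _)
  let It : ℝ → ℝ → ℝ := fun t x => (1 - t) * I x + t * J x
  let W : ℝ → Ω → ℝ := fun t ω => finalWealth μ X 0 w (It t) (X ω)
  have hItω : ∀ t ω, It t (X ω) = I (X ω) + t * H ω := fun t ω => by simp only [It, H]; ring
  have hmean : ∀ t, ∫ ω, It t (X ω) ∂μ
      = ∫ ω, I (X ω) ∂μ + t * (∫ ω, J (X ω) ∂μ - ∫ ω, I (X ω) ∂μ) := by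
    intro t
    simp_rw [hItω]
    rw [integral_add (hI0.integrable hX hXM) ((hHL.integrable one_le_two).const_mul t),
      integral_const_mul, integral_sub (hJ.integrable hX hXM) (hI0.integrable hX hXM)]
  have hW : ∀ t ω, W t ω = finalWealth μ X 0 w I (X ω) + t * K ω := by
    intro t ω
    simp only [W, finalWealth, premium_zero, hmean]
    rw [hItω]
    ring
  have hIt : ∀ t ∈ Ioo (0 : ℝ) 1, IsIndemnity M (It t) := fun t ht =>
    hI0.convexComb hJ (by linarith [ht.2]) ht.1.le (by ring)
  have hvar : ∀ t, variance (fun ω => It t (X ω)) μ = variance (fun ω => I (X ω)) μ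
      + t * (2 * cov[fun ω => I (X ω), H; μ] + t * variance H μ) := by
    intro t
    simp_rw [hItω]
    rw [variance_fun_add (hI0.memLp hX hXM) (hHL.const_mul t), variance_const_mul,
      covariance_const_mul_right]
    ring
  -- the variance bound holds for all small `t > 0`
  have hadm : ∀ᶠ t in nhdsWithin (0 : ℝ) (Ioi 0), IsAdmissible μ X 0 ν (It t) := by
    have h1 : ∀ᶠ t in nhdsWithin (0 : ℝ) (Ioi 0), variance (fun ω => It t (X ω)) μ ≤ ν := by
      rcases hb with hb | hb
      · have hc : ContinuousAt (fun t : ℝ => variance (fun ω => I (X ω)) μ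
            + t * (2 * cov[fun ω => I (X ω), H; μ] + t * variance H μ)) 0 := by fun_prop
        have := hc.eventually_lt (continuousAt_const (y := ν)) (by simpa using hb)
        filter_upwards [nhdsWithin_le_nhds this] with t ht
        rw [hvar]; exact ht.le
      · have hc : ContinuousAt (fun t : ℝ =>
            2 * cov[fun ω => I (X ω), H; μ] + t * variance H μ) 0 := by fun_prop
        have := hc.eventually_lt (continuousAt_const (y := 0)) (by simp only [zero_mul]; linarith)
        filter_upwards [nhdsWithin_le_nhds this, self_mem_nhdsWithin] with t ht ht0
        rw [hvar]
        linarith [mul_neg_of_pos_of_neg ht0 ht]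
    filter_upwards [h1, Ioo_mem_nhdsGT (zero_lt_one (α := ℝ))] with t ht ht1
    exact ⟨hIt t ht1, by rwa [variance_riskExposure ((hIt t ht1).measurable_comp hX)]⟩
  obtain ⟨s, hs, hs0⟩ := (hadm.and self_mem_nhdsWithin).exists
  -- all the wealth levels for `0 ≤ t ≤ s` stay in `[lo, w] ⊆ D`
  have hI' : IsAdmissible μ X 0 ν I :=
    ⟨hI0, by rwa [variance_riskExposure (hI0.measurable_comp hX)]⟩
  set lo := min (w - M - ∫ ω, I (X ω) ∂μ) (w - M - ∫ ω, It s (X ω) ∂μ) with hlo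
  have hloD : lo ∈ D := by
    rcases min_choice (w - M - ∫ ω, I (X ω) ∂μ) (w - M - ∫ ω, It s (X ω) ∂μ) with h | h
    · rw [hlo, h]; exact hw.2 I hI'
    · rw [hlo, h]; exact hw.2 _ hs
  have hsub : Icc lo w ⊆ D := hU.ordConnected.out hloD hw.1
  have hW0mem : ∀ᵐ ω ∂μ, finalWealth μ X 0 w I (X ω) ∈ Icc lo w := by
    filter_upwards [hXM] with ω hω
    have h := finalWealth_mem_Icc (w := w) hI0 hXM hω
    exact ⟨(min_le_left _ _).trans h.1, h.2⟩
  have hWmem : ∀ᵐ ω ∂μ, ∀ t ∈ Ioo 0 s, W t ω ∈ Icc lo w := by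
    filter_upwards [hXM, hW0mem] with ω hω h0 t ht
    have h := finalWealth_mem_Icc (w := w) hs.1 hXM hω
    have h1 : W s ω ∈ Icc lo w := ⟨(min_le_right _ _).trans h.1, h.2⟩
    have hst : t / s ≤ 1 := (div_le_one hs0).2 ht.2.le
    have h2 := (convex_Icc lo w) h0 h1 (sub_nonneg.2 hst) (div_nonneg ht.1.le (le_of_lt hs0))
      (by ring)
    convert h2 using 1
    rw [hW, hW, smul_eq_mul, smul_eq_mul]
    have : s ≠ 0 := ne_of_gt hs0
    field_simp
    ring
  have hWm : ∀ t, Measurable (W t) := by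
    intro t
    have : W t = fun ω => finalWealth μ X 0 w I (X ω) + t * K ω := funext (hW t)
    rw [this]
    exact (measurable_finalWealth hI0 hX).add (hKm.const_mul t)
  have hloD' := hU.continuousOn.mono hsub
  have hlim : Filter.Tendsto (fun t => ∫ ω, deriv U (W t ω) * K ω ∂μ)
      (nhdsWithin (0 : ℝ) (Ioi 0))
      (nhds (∫ ω, deriv U (finalWealth μ X 0 w I (X ω)) * K ω ∂μ)) := by
    refine tendsto_integral_filter_of_dominated_convergence (fun ω => deriv U lo * |K ω|)
      (Filter.Eventually.of_forall fun t =>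
        (((measurable_deriv U).comp (hWm t)).mul hKm).aestronglyMeasurable) ?_
      (hKint.abs.const_mul _) ?_
    · filter_upwards [Ioo_mem_nhdsGT hs0] with t ht
      filter_upwards [hWmem] with ω hω
      have h1 := hsub (hω t ht)
      rw [norm_mul, Real.norm_eq_abs, Real.norm_eq_abs, abs_of_pos (hU.deriv_pos _ h1)]
      exact mul_le_mul_of_nonneg_right
        (hU.strictAntiOn_deriv.antitoneOn hloD h1 (hω t ht).1) (abs_nonneg _)
    · filter_upwards [hW0mem] with ω hω
      have h1 : Filter.Tendsto (fun t => W t ω) (nhdsWithin (0 : ℝ) (Ioi 0))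
          (nhds (finalWealth μ X 0 w I (X ω))) := by
        simp_rw [hW]
        have : ContinuousAt (fun t : ℝ => finalWealth μ X 0 w I (X ω) + t * K ω) 0 := by
          fun_prop
        simpa [ContinuousAt] using this.tendsto.mono_left nhdsWithin_le_nhds
      exact ((hU.diff_two _ (hsub hω)).continuousAt.tendsto.comp h1).mul_const _
  refine le_of_tendsto hlim ?_
  filter_upwards [hadm, Ioo_mem_nhdsGT hs0] with t ht hts
  have hi0 : Integrable (fun ω => U (finalWealth μ X 0 w I (X ω))) μ :=
    integrable_comp_of_continuousOn hloD' (measurable_finalWealth hI0 hX).aemeasurable hW0mem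
  have hit : Integrable (fun ω => U (W t ω)) μ :=
    integrable_comp_of_continuousOn hloD' (hWm t).aemeasurable (hWmem.mono fun ω h => h t hts)
  have hdt : Integrable (fun ω => deriv U (W t ω)) μ :=
    integrable_comp_of_continuousOn (hU.continuousOn_deriv.mono hsub) (hWm t).aemeasurable
      (hWmem.mono fun ω h => h t hts)
  obtain ⟨C, hC⟩ := isCompact_Icc.exists_bound_of_continuousOn (hU.continuousOn_deriv.mono hsub)
  have hprod : Integrable (fun ω => deriv U (W t ω) * K ω) μ :=
    hKint.bdd_mul hdt.aestronglyMeasurable (hWmem.mono fun ω h => hC _ (h t hts))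
  have hle : ∫ ω, t * (deriv U (W t ω) * K ω) ∂μ
      ≤ ∫ ω, (U (W t ω) - U (finalWealth μ X 0 w I (X ω))) ∂μ := by
    refine integral_mono_ae (hprod.const_mul t) (hit.sub hi0) ?_
    filter_upwards [hW0mem, hWmem] with ω h0 h1
    have h2 := hU.deriv_mul_sub_le (hsub h0) (hsub (h1 t hts))
    have h3 : W t ω - finalWealth μ X 0 w I (X ω) = t * K ω := by rw [hW]; ring
    rw [h3] at h2
    linarith
  rw [integral_sub hit hi0, integral_const_mul] at hle
  have := hopt _ ht
  by_contra! hpos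
  have := mul_pos hts.1 hpos
  linarith

end FirstOrder

end Indemnity

/-! ### Stationarity of optimal contracts -/

section Stationarity

variable {Ω : Type*} [MeasurableSpace Ω] {μ : Measure Ω}
  {X : Ω → ℝ} {ν w : ℝ} {D : Set ℝ} {U I : ℝ → ℝ}

theorem WealthInDomain.Icc_subset (hU : IsUtility D U) (hw : WealthInDomain μ X ν D w)
    (hI : IsAdmissible μ X 0 ν I) : Icc (w - essSup X μ - ∫ ω, I (X ω) ∂μ) w ⊆ D :=
  hU.ordConnected.out (hw.2 I hI) hw.1

variable [IsProbabilityMeasure μ]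

theorem integrable_deriv_finalWealth (hX : Measurable X)
    (hXM : ∀ᵐ ω ∂μ, X ω ∈ Icc 0 (essSup X μ)) (hU : IsUtility D U)
    (hw : WealthInDomain μ X ν D w) (hI : IsAdmissible μ X 0 ν I) :
    Integrable (fun ω => deriv U (finalWealth μ X 0 w I (X ω))) μ := by
  refine integrable_comp_of_continuousOn
    (hU.continuousOn_deriv.mono (hw.Icc_subset hU hI))
    (measurable_finalWealth hI.1 hX).aemeasurable ?_
  filter_upwards [hXM] with ω hω using finalWealth_mem_Icc hI.1 hXM hω

/-- The variational inequality: the Lagrangian gradient at the optimal contract is nonpositive in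
every feasible direction, for a multiplier `l` that vanishes if the variance bound is slack. -/
theorem IsOptimalContract.exists_variational (hX : Measurable X)
    (hXM : ∀ᵐ ω ∂μ, X ω ∈ Icc 0 (essSup X μ)) (hν : 0 < ν) (hU : IsUtility D U)
    (hw : WealthInDomain μ X ν D w) (hI : IsOptimalContract μ X U w 0 ν I) :
    ∃ l : ℝ, 0 ≤ l ∧ (l = 0 ∨ variance (fun ω => I (X ω)) μ = ν) ∧
      ∀ J, IsIndemnity (essSup X μ) J →
        ∫ ω, (deriv U (finalWealth μ X 0 w I (X ω))
          - ∫ ω, deriv U (finalWealth μ X 0 w I (X ω)) ∂μ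
          - l * riskExposure μ X 0 I (X ω)) * (J (X ω) - I (X ω)) ∂μ ≤ 0 := by
  have hI0 := hI.1.1
  have hd := integrable_deriv_finalWealth hX hXM hU hw hI.1
  set V : Ω → ℝ := fun ω => deriv U (finalWealth μ X 0 w I (X ω)) with hV
  set c := ∫ ω, V ω ∂μ with hc
  have hIint := hI0.integrable hX hXM
  have hVm : Measurable V := (measurable_deriv U).comp (measurable_finalWealth hI0 hX)
  have hVIcc : ∀ᵐ ω ∂μ, V ω ∈ Icc (deriv U w)
      (deriv U (w - essSup X μ - ∫ ω, I (X ω) ∂μ)) := by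
    filter_upwards [hXM] with ω hω
    have h := finalWealth_mem_Icc (w := w) hI0 hXM hω
    have hD := hw.Icc_subset hU hI.1 h
    exact ⟨hU.strictAntiOn_deriv.antitoneOn hD hw.1 h.2,
      hU.strictAntiOn_deriv.antitoneOn (hw.2 I hI.1) hD h.1⟩
  have hV2 : MemLp V 2 μ := memLp_of_bounded hVIcc hVm.aestronglyMeasurable 2
  have hI2 := hI0.memLp hX hXM
  have he2 : MemLp (fun ω => riskExposure μ X 0 I (X ω)) 2 μ := hI2.sub (memLp_const _)
  have hVc2 : MemLp (fun ω => V ω - c) 2 μ := hV2.sub (memLp_const _)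
  have hH2 : ∀ J, IsIndemnity (essSup X μ) J → MemLp (fun ω => J (X ω) - I (X ω)) 2 μ :=
    fun J hJ => (hJ.memLp hX hXM).sub hI2
  have hi1 : ∀ J, IsIndemnity (essSup X μ) J →
      Integrable (fun ω => (V ω - c) * (J (X ω) - I (X ω))) μ :=
    fun J hJ => hVc2.integrable_mul (hH2 J hJ)
  have hi2 : ∀ J, IsIndemnity (essSup X μ) J →
      Integrable (fun ω => riskExposure μ X 0 I (X ω) * (J (X ω) - I (X ω))) μ :=
    fun J hJ => he2.integrable_mul (hH2 J hJ)
  have hcov : ∀ J, IsIndemnity (essSup X μ) J →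
      cov[fun ω => I (X ω), fun ω => J (X ω) - I (X ω); μ]
        = ∫ ω, riskExposure μ X 0 I (X ω) * (J (X ω) - I (X ω)) ∂μ := by
    intro J hJ
    have hei := he2.integrable one_le_two
    have hz : ∫ ω, riskExposure μ X 0 I (X ω) ∂μ = 0 := by
      simp only [riskExposure, premium_zero]
      rw [integral_sub hIint (integrable_const _)]
      simp
    have : ∀ ω, (I (X ω) - ∫ ω, I (X ω) ∂μ) * (J (X ω) - I (X ω)
          - ∫ ω, (J (X ω) - I (X ω)) ∂μ)
        = riskExposure μ X 0 I (X ω) * (J (X ω) - I (X ω))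
          - riskExposure μ X 0 I (X ω) * ∫ ω, (J (X ω) - I (X ω)) ∂μ := fun ω => by
      simp only [riskExposure, premium_zero]; ring
    rw [covariance]
    simp_rw [this]
    rw [integral_sub (hi2 J hJ) (hei.mul_const _), integral_mul_const, hz]
    ring
  have hgain : ∀ J, IsIndemnity (essSup X μ) J →
      ∫ ω, V ω * (J (X ω) - I (X ω) - (∫ ω, J (X ω) ∂μ - ∫ ω, I (X ω) ∂μ)) ∂μ
        = ∫ ω, (V ω - c) * (J (X ω) - I (X ω)) ∂μ := by
    intro J hJ
    have hHi := (hH2 J hJ).integrable one_le_two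
    have hJi := hJ.integrable hX hXM
    have hVH : Integrable (fun ω => V ω * (J (X ω) - I (X ω))) μ :=
      hV2.integrable_mul (hH2 J hJ)
    simp_rw [mul_sub (V _) (J _ - I _), sub_mul (V _) c]
    rw [integral_sub hVH (hd.mul_const _), integral_sub hVH (hHi.const_mul c),
      integral_mul_const, integral_const_mul, integral_sub hJi hIint]
  have hvar_le : variance (fun ω => I (X ω)) μ ≤ ν := by
    rw [← variance_riskExposure (hI0.measurable_comp hX) 0]; exact hI.1.2
  rcases hvar_le.lt_or_eq with hlt | heq
  · refine ⟨0, le_rfl, Or.inl rfl, fun J hJ => ?_⟩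
    have := hI.first_order hX hXM hU hw hJ (Or.inl hlt)
    rw [hgain J hJ] at this
    simpa using this
  · -- the pairs (first-order gain, first-order change of the variance) over the feasible set
    set K : Set (ℝ × ℝ) := (fun J : ℝ → ℝ => (∫ ω, (V ω - c) * (J (X ω) - I (X ω)) ∂μ,
      ∫ ω, riskExposure μ X 0 I (X ω) * (J (X ω) - I (X ω)) ∂μ)) ''
        {J | IsIndemnity (essSup X μ) J} with hK
    have hconv : Convex ℝ K := by
      rintro _ ⟨J₁, h1, rfl⟩ _ ⟨J₂, h2, rfl⟩ a b ha hb hab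
      refine ⟨fun x => a * J₁ x + b * J₂ x, h1.convexComb h2 ha hb hab, ?_⟩
      have hs : ∀ ω, a * J₁ (X ω) + b * J₂ (X ω) - I (X ω)
          = a * (J₁ (X ω) - I (X ω)) + b * (J₂ (X ω) - I (X ω)) := fun ω => by
        linear_combination I (X ω) * hab
      have hl : ∀ f : Ω → ℝ, Integrable (fun ω => f ω * (J₁ (X ω) - I (X ω))) μ →
          Integrable (fun ω => f ω * (J₂ (X ω) - I (X ω))) μ →
          ∫ ω, f ω * (a * J₁ (X ω) + b * J₂ (X ω) - I (X ω)) ∂μ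
            = a * ∫ ω, f ω * (J₁ (X ω) - I (X ω)) ∂μ
              + b * ∫ ω, f ω * (J₂ (X ω) - I (X ω)) ∂μ := by
        intro f hf1 hf2
        rw [← integral_const_mul, ← integral_const_mul,
          ← integral_add (hf1.const_mul a) (hf2.const_mul b)]
        refine integral_congr_ae (Filter.Eventually.of_forall fun ω => ?_)
        simp only [hs]; ring
      ext
      · exact hl _ (hi1 _ h1) (hi1 _ h2)
      · exact hl _ (hi2 _ h1) (hi2 _ h2)
    obtain ⟨l, hl, hlK⟩ := exists_multiplier hconv ⟨I, hI0, by simp⟩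
      (by
        -- cancelling the contract decreases the variance
        refine ⟨_, ⟨fun _ => 0, IsIndemnity.zero, rfl⟩, ?_⟩
        change ∫ ω, riskExposure μ X 0 I (X ω) * (0 - I (X ω)) ∂μ < 0
        rw [← hcov _ IsIndemnity.zero]
        simp only [zero_sub]
        rw [covariance_fun_neg_right, covariance_self (hI0.measurable_comp hX).aemeasurable, heq]
        linarith)
      (by
        rintro _ ⟨J, hJ, rfl⟩ hneg
        have := hI.first_order hX hXM hU hw hJ (Or.inr (by rw [hcov J hJ]; exact hneg))
        rwa [hgain J hJ] at this)
    refine ⟨l, hl, Or.inr heq, fun J hJ => ?_⟩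
    have h := hlK _ ⟨J, hJ, rfl⟩
    simp_rw [sub_mul (_ - c) (l * _), mul_assoc l]
    rw [integral_sub (hi1 J hJ) ((hi2 J hJ).const_mul l), integral_const_mul]
    simpa using h

/-- The optimal contract satisfies `U'(W_I) = c + l e_I` almost surely with a positive multiplier,
and the variance bound is tight. The variational inequality gives full indemnity where the
Lagrangian gradient is positive and none where it is negative; under a fair premium the gradient
has mean zero, and the two regions cannot both be charged. -/
theorem IsOptimalContract.exists_stationary (hX : Measurable X)
    (hXM : ∀ᵐ ω ∂μ, X ω ∈ Icc 0 (essSup X μ)) (hν : 0 < ν) (hνX : ν < variance X μ)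
    (hU : IsUtility D U) (hw : WealthInDomain μ X ν D w)
    (hI : IsOptimalContract μ X U w 0 ν I) :
    variance (fun ω => I (X ω)) μ = ν ∧ ∃ l c : ℝ, 0 < l ∧ ∀ᵐ ω ∂μ,
      deriv U (finalWealth μ X 0 w I (X ω)) = c + l * riskExposure μ X 0 I (X ω) := by
  have hI0 := hI.1.1
  obtain ⟨l, hl, hslack, hvi⟩ := hI.exists_variational hX hXM hν hU hw
  have hd := integrable_deriv_finalWealth hX hXM hU hw hI.1
  set c := ∫ ω, deriv U (finalWealth μ X 0 w I (X ω)) ∂μ with hc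
  set m := ∫ ω, I (X ω) ∂μ with hm
  set g : ℝ → ℝ := fun x => deriv U (finalWealth μ X 0 w I x) - c
    - l * riskExposure μ X 0 I x with hg
  have hIint := hI0.integrable hX hXM
  have heint : Integrable (fun ω => riskExposure μ X 0 I (X ω)) μ :=
    hIint.sub (integrable_const _)
  have hdc : Integrable (fun ω => deriv U (finalWealth μ X 0 w I (X ω)) - c) μ :=
    hd.sub (integrable_const _)
  have hgint : Integrable (fun ω => g (X ω)) μ := hdc.sub (heint.const_mul l)
  have hg0 : ∫ ω, g (X ω) ∂μ = 0 := by
    simp only [hg]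
    rw [integral_sub hdc (heint.const_mul l),
      integral_sub hd (integrable_const _), integral_const_mul]
    simp only [riskExposure, premium_zero]
    rw [integral_sub hIint (integrable_const _)]
    simp [hc]
  have hgm : Measurable g := by
    have h1 : Measurable (fun x => finalWealth μ X 0 w I x) :=
      ((measurable_id.const_sub w).add hI0.1).sub_const _
    exact (((measurable_deriv U).comp h1).sub_const _).sub ((hI0.1.sub_const _).const_mul l)
  -- test against full indemnity where `g > 0` and none elsewhere
  have hgood : ∀ᵐ ω ∂μ, (0 < g (X ω) → I (X ω) = X ω) ∧ (g (X ω) < 0 → I (X ω) = 0) := by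
    classical
    set J : ℝ → ℝ := fun x => if 0 < g x then x else 0 with hJ
    have hJi : IsIndemnity (essSup X μ) J := by
      refine ⟨Measurable.ite (measurableSet_lt measurable_const hgm) measurable_id
        measurable_const, fun x hx => ?_⟩
      simp only [hJ]
      split_ifs
      · exact ⟨hx.1, le_rfl⟩
      · exact ⟨le_rfl, hx.1⟩
    have h1 := hvi J hJi
    have h2 : 0 ≤ᵐ[μ] fun ω => g (X ω) * (J (X ω) - I (X ω)) := by
      filter_upwards [hXM] with ω hω
      obtain ⟨h3, h4⟩ := hI0.2 _ hω
      simp only [hJ, Pi.zero_apply]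
      split_ifs with h
      · exact mul_nonneg h.le (by linarith)
      · exact mul_nonneg_of_nonpos_of_nonpos (not_lt.1 h) (by linarith)
    have hbdd : ∀ᵐ ω ∂μ, ‖J (X ω) - I (X ω)‖ ≤ essSup X μ := by
      filter_upwards [hI0.ae_mem_Icc hXM, hJi.ae_mem_Icc hXM] with ω h3 h4
      rw [Real.norm_eq_abs, abs_le]
      constructor <;> linarith [h3.1, h3.2, h4.1, h4.2]
    have hint : Integrable (fun ω => g (X ω) * (J (X ω) - I (X ω))) μ :=
      hgint.mul_bdd ((hJi.measurable_comp hX).sub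
        (hI0.measurable_comp hX)).aestronglyMeasurable hbdd
    have h5 := (integral_eq_zero_iff_of_nonneg_ae h2 hint).1
      (le_antisymm h1 (integral_nonneg_of_ae h2))
    filter_upwards [h5] with ω hω
    simp only [hJ, Pi.zero_apply, mul_eq_zero] at hω
    constructor
    · intro h
      rw [if_pos h] at hω
      rcases hω with h' | h' <;> linarith
    · intro h
      rw [if_neg h.not_gt] at hω
      rcases hω with h' | h' <;> linarith
  have hmem : ∀ {x}, x ∈ Icc 0 (essSup X μ) → finalWealth μ X 0 w I x ∈ D := fun hx =>
    hw.Icc_subset hU hI.1 (finalWealth_mem_Icc hI0 hXM hx)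
  -- full and zero indemnity are incompatible: the former has the smaller marginal utility
  have hcases : (∀ᵐ ω ∂μ, g (X ω) ≤ 0) ∨ (∀ᵐ ω ∂μ, 0 ≤ g (X ω)) := by
    by_contra! h
    obtain ⟨ω₁, p1, g1, m1⟩ := (h.1.and_eventually (hgood.and hXM)).exists
    obtain ⟨ω₂, p2, g2, m2⟩ := (h.2.and_eventually (hgood.and hXM)).exists
    have i1 := g1.1 p1
    have i2 := g2.2 p2
    have d1 := hmem m1
    have d2 := hmem m2
    simp only [hg, finalWealth, riskExposure, premium_zero, i1, i2, ← hm] at p1 p2 d1 d2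
    have := hU.strictAntiOn_deriv.antitoneOn d2 d1 (by linarith [m2.1])
    nlinarith [mul_nonneg hl m1.1]
  have hzero : ∀ᵐ ω ∂μ, g (X ω) = 0 := by
    rcases hcases with h | h
    · have h1 := (integral_eq_zero_iff_of_nonneg_ae (μ := μ) (f := fun ω => -g (X ω))
        (h.mono fun ω hω => by simpa using hω) hgint.neg).1 (by rw [integral_neg, hg0, neg_zero])
      filter_upwards [h1] with ω hω using by simpa using hω
    · exact (integral_eq_zero_iff_of_nonneg_ae h hgint).1 hg0
  have hl0 : l ≠ 0 := by
    intro hl0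
    -- with a zero multiplier final wealth is constant, so that the variance is that of `X`
    obtain ⟨ω₀, z0, m0⟩ := (hzero.and hXM).exists
    have hconst : (fun ω => I (X ω)) =ᵐ[μ]
        fun ω => X ω + (finalWealth μ X 0 w I (X ω₀) - w + m) := by
      filter_upwards [hzero, hXM] with ω z mω
      simp only [hg, hl0, zero_mul, sub_zero] at z z0
      have := hU.strictAntiOn_deriv.injOn (hmem mω) (hmem m0) (by linarith)
      rw [← this]
      simp only [finalWealth, premium_zero, ← hm]
      ring
    have h1 : variance (fun ω => I (X ω)) μ = variance X μ := by
      rw [variance_congr hconst, variance_add_const hX.aestronglyMeasurable]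
    have h2 := hI.1.2
    rw [variance_riskExposure (hI0.measurable_comp hX), h1] at h2
    linarith
  refine ⟨hslack.resolve_left hl0, l, c, lt_of_le_of_ne hl (Ne.symm hl0), ?_⟩
  filter_upwards [hzero] with ω hω
  simp only [hg] at hω
  linarith

end Stationarity

/-! ### Full support and continuous versions -/

section Crossing

variable {Ω : Type*} [MeasurableSpace Ω] {μ : Measure Ω}
  {X : Ω → ℝ} {ν w : ℝ} {D : Set ℝ} {U I J : ℝ → ℝ}

/-- A contract on which `U'(W_I) = c + l e_I` almost surely has a continuous version: the relation
makes final wealth a contraction of the loss. -/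
theorem exists_isContinuousVersion (hXM : ∀ᵐ ω ∂μ, X ω ∈ Icc 0 (essSup X μ))
    (hU : IsUtility D U) (hw : WealthInDomain μ X ν D w) (hI : IsAdmissible μ X 0 ν I) {l c : ℝ}
    (hl : 0 < l) (hst : ∀ᵐ ω ∂μ,
      deriv U (finalWealth μ X 0 w I (X ω)) = c + l * riskExposure μ X 0 I (X ω)) :
    ∃ J : ℝ → ℝ, IsContinuousVersion μ X I J := by
  set W := finalWealth μ X 0 w I with hW
  set S : Set ℝ := {x | x ∈ Icc 0 (essSup X μ) ∧
    deriv U (W x) = c + l * riskExposure μ X 0 I x} with hS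
  have hWD : ∀ x ∈ S, W x ∈ D := fun x hx =>
    hw.Icc_subset hU hI (finalWealth_mem_Icc hI.1 hXM hx.1)
  have he : ∀ x, riskExposure μ X 0 I x = W x - w + x := fun x => by
    simp only [hW, riskExposure, finalWealth]; ring
  have hsub : ∀ x ∈ S, ∀ y ∈ S, W x - W y ≤ |x - y| := by
    intro x hx y hy
    rcases le_or_gt (W x) (W y) with h | h
    · linarith [abs_nonneg (x - y)]
    · have h1 := hU.strictAntiOn_deriv (hWD y hy) (hWD x hx) h
      rw [hx.2, hy.2, he, he] at h1
      have h2 : W x - w + x < W y - w + y := lt_of_mul_lt_mul_left (by linarith) hl.le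
      linarith [neg_abs_le (x - y)]
  have hlip : LipschitzOnWith 1 W S := LipschitzOnWith.of_dist_le_mul fun x hx y hy => by
    rw [NNReal.coe_one, one_mul, Real.dist_eq, Real.dist_eq, abs_le]
    have h1 := hsub x hx y hy
    have h2 := hsub y hy x hx
    rw [abs_sub_comm] at h2
    constructor <;> linarith
  obtain ⟨V, hV, hVW⟩ := hlip.extend_real
  refine ⟨fun x => V x - w + x + ∫ ω, I (X ω) ∂μ, ?_, ?_⟩
  · have := hV.continuous
    fun_prop
  · filter_upwards [hst, hXM] with ω h1 h2
    rw [← hVW ⟨h2, h1⟩]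
    simp only [hW, finalWealth, premium_zero]
    ring

variable [IsProbabilityMeasure μ]

/-- A strictly increasing distribution function gives the loss full support. -/
theorem Icc_subset_closure_of_ae {M : ℝ} (hM : 0 < M)
    (hF : StrictMonoOn (cdfOf μ X) (Ioo 0 M)) {p : ℝ → Prop} (hp : ∀ᵐ ω ∂μ, p (X ω)) :
    Icc 0 M ⊆ closure {x | x ∈ Icc 0 M ∧ p x} := by
  refine (closure_Ioo hM.ne).symm.subset.trans
    (closure_minimal (fun x hx => ?_) isClosed_closure)
  rw [Metric.mem_closure_iff]
  intro ε hε
  set y := min (x + ε / 2) ((x + M) / 2) with hy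
  have hxy : x < y := lt_min (by linarith) (by linarith [hx.2])
  have hyM : y < M := (min_le_right _ _).trans_lt (by linarith [hx.2])
  have hlt := hF hx ⟨hx.1.trans hxy, hyM⟩ hxy
  obtain ⟨ω, hω, h1, h2⟩ : ∃ ω, p (X ω) ∧ x < X ω ∧ X ω ≤ y := by
    by_contra! h
    refine hlt.not_ge (ENNReal.toReal_mono (measure_ne_top _ _) (measure_mono_ae ?_))
    filter_upwards [hp] with ω hω hωy
    by_contra hx'
    exact absurd hωy (not_le.2 (h ω hω (not_le.1 hx')))
  refine ⟨X ω, ⟨⟨(hx.1.trans h1).le, h2.trans hyM.le⟩, hω⟩, ?_⟩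
  rw [dist_comm, Real.dist_eq, abs_of_pos (by linarith)]
  linarith [min_le_left (x + ε / 2) ((x + M) / 2)]

/-- A nonnegative continuous function of a loss with full support vanishes if its mean does. -/
theorem eqOn_zero_of_integral_eq_zero {M : ℝ} (hM : 0 < M) (hX : Measurable X)
    (hXM : ∀ᵐ ω ∂μ, X ω ∈ Icc 0 M) (hF : StrictMonoOn (cdfOf μ X) (Ioo 0 M)) {f : ℝ → ℝ}
    (hf : ContinuousOn f (Icc 0 M)) (h0 : ∀ x ∈ Icc 0 M, 0 ≤ f x)
    (hint : ∫ ω, f (X ω) ∂μ = 0) : ∀ x ∈ Icc 0 M, f x = 0 := by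
  have hae : 0 ≤ᵐ[μ] fun ω => f (X ω) := hXM.mono fun ω h => h0 _ h
  have h1 := (integral_eq_zero_iff_of_nonneg_ae hae
    (integrable_comp_of_continuousOn hf hX.aemeasurable hXM)).1 hint
  exact EqOn.of_subset_closure (fun x hx => hx.2) hf continuousOn_const (fun x hx => hx.1)
    (Icc_subset_closure_of_ae hM hF (p := fun x => f x = 0) h1)

/-- The continuous version satisfies everywhere on `[0, M]` what the contract satisfies almost
surely. -/
theorem IsContinuousVersion.stationary (hXM : ∀ᵐ ω ∂μ, X ω ∈ Icc 0 (essSup X μ))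
    (hM : 0 < essSup X μ) (hF : StrictMonoOn (cdfOf μ X) (Ioo 0 (essSup X μ)))
    (hU : IsUtility D U) (hw : WealthInDomain μ X ν D w) (hI : IsAdmissible μ X 0 ν I) {l c : ℝ}
    (hst : ∀ᵐ ω ∂μ,
      deriv U (finalWealth μ X 0 w I (X ω)) = c + l * riskExposure μ X 0 I (X ω))
    (hJ : IsContinuousVersion μ X I J) :
    ∀ x ∈ Icc 0 (essSup X μ), w - x + riskExposure μ X 0 J x ∈ D ∧
      w - x + riskExposure μ X 0 J x ≤ w ∧
      deriv U (w - x + riskExposure μ X 0 J x) = c + l * riskExposure μ X 0 J x := by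
  obtain ⟨hJc, hJI⟩ := hJ
  have hprem : ∫ ω, J (X ω) ∂μ = ∫ ω, I (X ω) ∂μ := integral_congr_ae hJI
  have hecont : ContinuousOn (riskExposure μ X 0 J) (Icc 0 (essSup X μ)) :=
    hJc.sub continuousOn_const
  have hWcont : ContinuousOn (fun x => w - x + riskExposure μ X 0 J x)
      (Icc 0 (essSup X μ)) := (continuousOn_const.sub continuousOn_id).add hecont
  have hp : ∀ᵐ ω ∂μ, w - X ω + riskExposure μ X 0 J (X ω) = finalWealth μ X 0 w I (X ω) ∧
      deriv U (w - X ω + riskExposure μ X 0 J (X ω)) = c + l * riskExposure μ X 0 J (X ω) := by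
    filter_upwards [hJI, hst] with ω h1 h2
    have h3 : riskExposure μ X 0 J (X ω) = riskExposure μ X 0 I (X ω) := by
      simp only [riskExposure, premium_zero, hprem, h1]
    have h4 : w - X ω + riskExposure μ X 0 J (X ω) = finalWealth μ X 0 w I (X ω) := by
      rw [h3]; simp only [riskExposure, finalWealth]; ring
    exact ⟨h4, by rw [h4, h2, h3]⟩
  have hdense := Icc_subset_closure_of_ae hM hF (p := fun x =>
    w - x + riskExposure μ X 0 J x = finalWealth μ X 0 w I x ∧
      deriv U (w - x + riskExposure μ X 0 J x) = c + l * riskExposure μ X 0 J x) hp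
  have hmaps : MapsTo (fun x => w - x + riskExposure μ X 0 J x) (Icc 0 (essSup X μ))
      (Icc (w - essSup X μ - ∫ ω, I (X ω) ∂μ) w) := by
    intro x hx
    refine isClosed_Icc.closure_subset
      (((hWcont x hx).mono fun y hy => hy.1).mem_closure (hdense hx) ?_)
    rintro y ⟨hy, hy1, -⟩
    simp only [hy1]
    exact finalWealth_mem_Icc hI.1 hXM hy
  have hsub := hw.Icc_subset hU hI
  have heq : EqOn (fun x => deriv U (w - x + riskExposure μ X 0 J x))
      (fun x => c + l * riskExposure μ X 0 J x) (Icc 0 (essSup X μ)) :=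
    EqOn.of_subset_closure (fun x hx => hx.2.2)
      ((hU.continuousOn_deriv.mono hsub).comp hWcont hmaps)
      (continuousOn_const.add (continuousOn_const.mul hecont)) (fun x hx => hx.1) hdense
  exact fun x hx => ⟨hsub (hmaps hx), (hmaps hx).2, heq hx⟩

/-! ### Comparison of two stationary exposures -/

/-- An exposure `e` on `[0, M]` solving `U'(w - x + e x) = c + l e x` within the domain. -/
def SolvesStationarity (D : Set ℝ) (U : ℝ → ℝ) (M w l c : ℝ) (e : ℝ → ℝ) : Prop :=
  ∀ x ∈ Icc 0 M, w - x + e x ∈ D ∧ w - x + e x ≤ w ∧ deriv U (w - x + e x) = c + l * e x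

namespace SolvesStationarity

variable {M l c w₁ w₂ l₁ l₂ c₁ c₂ : ℝ} {e e₁ e₂ : ℝ → ℝ}

theorem strictAntiOn (hU : IsUtility D U) (hl : 0 < l) (h : SolvesStationarity D U M w l c e) :
    StrictAntiOn (fun x => w - x + e x) (Icc 0 M) := by
  intro x hx y hy hxy
  by_contra! hle
  have h1 := hU.strictAntiOn_deriv.antitoneOn (h x hx).1 (h y hy).1 hle
  rw [(h x hx).2.2, (h y hy).2.2] at h1
  have : e y ≤ e x := le_of_mul_le_mul_left (by linarith) hl
  linarith

theorem strictMonoOn (hU : IsUtility D U) (hl : 0 < l) (h : SolvesStationarity D U M w l c e) :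
    StrictMonoOn e (Icc 0 M) := by
  intro x hx y hy hxy
  have h1 := hU.strictAntiOn_deriv (h y hy).1 (h x hx).1 (h.strictAntiOn hU hl hx hy hxy)
  rw [(h x hx).2.2, (h y hy).2.2] at h1
  exact lt_of_mul_lt_mul_left (by linarith) hl.le

/-- Inserting `e₁` into the equation of `e₂` leaves a defect whose sign is that of `e₂ - e₁`, and
which is a function of the wealth level belonging to `e₁` alone. -/
theorem defect (hU : IsUtility D U) (hw : w₁ < w₂) (hw₂ : w₂ ∈ D) (hl₁ : 0 < l₁) (hl₂ : 0 < l₂)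
    (h₁ : SolvesStationarity D U M w₁ l₁ c₁ e₁) (h₂ : SolvesStationarity D U M w₂ l₂ c₂ e₂)
    {x : ℝ} (hx : x ∈ Icc 0 M) :
    (e₁ x ≤ e₂ x → c₂ - l₂ / l₁ * c₁ ≤ deriv U (w₁ - x + e₁ x + (w₂ - w₁))
      - l₂ / l₁ * deriv U (w₁ - x + e₁ x)) ∧
    (e₂ x < e₁ x → deriv U (w₁ - x + e₁ x + (w₂ - w₁))
      - l₂ / l₁ * deriv U (w₁ - x + e₁ x) < c₂ - l₂ / l₁ * c₁) ∧
    (e₂ x = e₁ x → deriv U (w₁ - x + e₁ x + (w₂ - w₁))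
      - l₂ / l₁ * deriv U (w₁ - x + e₁ x) = c₂ - l₂ / l₁ * c₁) := by
  obtain ⟨a1, a2, a3⟩ := h₁ x hx
  obtain ⟨b1, b2, b3⟩ := h₂ x hx
  have hs : w₁ - x + e₁ x + (w₂ - w₁) = w₂ - x + e₁ x := by ring
  have hD : w₂ - x + e₁ x ∈ D := hU.ordConnected.out a1 hw₂ ⟨by linarith, by linarith⟩
  have hr : l₂ / l₁ * (c₁ + l₁ * e₁ x) = l₂ / l₁ * c₁ + l₂ * e₁ x := by field_simp
  rw [hs, a3, hr]
  refine ⟨fun h => ?_, fun h => ?_, fun h => ?_⟩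
  · have := hU.strictAntiOn_deriv.antitoneOn hD b1 (by linarith)
    nlinarith
  · have := hU.strictAntiOn_deriv b1 hD (by linarith)
    nlinarith
  · rw [h] at b3
    linarith

/-- The set where the exposure at the higher wealth is the larger one is an interval. -/
theorem le_of_le_of_le (hU : IsUtility D U) (hDAP : StrictlyDAP D U) (hw : w₁ < w₂)
    (hw₂ : w₂ ∈ D) (hl₁ : 0 < l₁) (hl₂ : 0 < l₂)
    (h₁ : SolvesStationarity D U M w₁ l₁ c₁ e₁) (h₂ : SolvesStationarity D U M w₂ l₂ c₂ e₂)
    {a b c : ℝ} (ha : 0 ≤ a) (hab : a < b) (hbc : b < c) (hc : c ≤ M) (hea : e₁ a ≤ e₂ a)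
    (hec : e₁ c ≤ e₂ c) : e₁ b ≤ e₂ b := by
  by_contra! hb
  have ma : a ∈ Icc 0 M := ⟨ha, by linarith⟩
  have mb : b ∈ Icc 0 M := ⟨by linarith, by linarith⟩
  have mc : c ∈ Icc 0 M := ⟨by linarith, hc⟩
  have hanti := h₁.strictAntiOn hU hl₁
  have da := (h₁.defect hU hw hw₂ hl₁ hl₂ h₂ ma).1 hea
  have db := (h₁.defect hU hw hw₂ hl₁ hl₂ h₂ mb).2.1 hb
  have dc := (h₁.defect hU hw hw₂ hl₁ hl₂ h₂ mc).1 hec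
  exact hU.not_decrease_increase hDAP (sub_pos.2 hw) (l₂ / l₁) (h₁ c mc).1
    (hU.ordConnected.out (h₁ a ma).1 hw₂ ⟨by linarith, by linarith [(h₁ a ma).2.1]⟩)
    (hanti mb mc hbc) (hanti ma mb hab) (by linarith) (by linarith)

/-- The two exposures do not agree on an interval. -/
theorem exists_ne (hU : IsUtility D U) (hDAP : StrictlyDAP D U) (hw : w₁ < w₂)
    (hw₂ : w₂ ∈ D) (hl₁ : 0 < l₁) (hl₂ : 0 < l₂)
    (h₁ : SolvesStationarity D U M w₁ l₁ c₁ e₁) (h₂ : SolvesStationarity D U M w₂ l₂ c₂ e₂)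
    {a c : ℝ} (ha : 0 ≤ a) (hac : a < c) (hc : c ≤ M) : ∃ x ∈ Ioo a c, e₂ x ≠ e₁ x := by
  by_contra! heq
  have hanti := h₁.strictAntiOn hU hl₁
  set d := (c - a) / 4 with hd
  have m : ∀ t, 0 < t → t < 4 → a + t * d ∈ Ioo a c := fun t h0 h4 =>
    ⟨by nlinarith, by nlinarith⟩
  have m' : ∀ t, 0 < t → t < 4 → a + t * d ∈ Icc 0 M := fun t h0 h4 =>
    ⟨by linarith [(m t h0 h4).1], by linarith [(m t h0 h4).2]⟩
  have dd := fun t (h0 : 0 < t) (h4 : t < 4) =>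
    (h₁.defect hU hw hw₂ hl₁ hl₂ h₂ (m' t h0 h4)).2.2 (heq _ (m t h0 h4))
  have d1 := dd 1 (by norm_num) (by norm_num)
  have d2 := dd 2 (by norm_num) (by norm_num)
  have d3 := dd 3 (by norm_num) (by norm_num)
  have m1 := m' 1 (by norm_num) (by norm_num)
  have m2 := m' 2 (by norm_num) (by norm_num)
  have m3 := m' 3 (by norm_num) (by norm_num)
  exact hU.not_decrease_increase hDAP (sub_pos.2 hw) (l₂ / l₁) (h₁ _ m3).1
    (hU.ordConnected.out (h₁ _ m1).1 hw₂ ⟨by linarith, by linarith [(h₁ _ m1).2.1]⟩)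
    (hanti m2 m3 (by linarith)) (hanti m1 m2 (by linarith)) (by linarith) (by linarith)

end SolvesStationarity

/-- A continuous `d` on `[0, M]`, nonnegative exactly on an interval and not vanishing on any
interval, changes sign twice if it is orthogonal to the constants and to a strictly increasing
function: a single change of sign would give its product with an increment of that function a
strict sign. -/
theorem exists_two_crossings {M : ℝ} (hM : 0 < M) (hX : Measurable X)
    (hXM : ∀ᵐ ω ∂μ, X ω ∈ Icc 0 M) (hF : StrictMonoOn (cdfOf μ X) (Ioo 0 M)) {d s : ℝ → ℝ}
    (hd : ContinuousOn d (Icc 0 M)) (hs : ContinuousOn s (Icc 0 M))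
    (hmono : StrictMonoOn s (Icc 0 M))
    (hord : ∀ a b c, 0 ≤ a → a < b → b < c → c ≤ M → 0 ≤ d a → 0 ≤ d c → 0 ≤ d b)
    (hne : ∀ a c, 0 ≤ a → a < c → c ≤ M → ∃ x ∈ Ioo a c, d x ≠ 0)
    (h0 : ∫ ω, d (X ω) ∂μ = 0) (h1 : ∫ ω, d (X ω) * s (X ω) ∂μ = 0) :
    ∃ z₀ z₁, 0 < z₀ ∧ z₀ < z₁ ∧ z₁ < M ∧ (∀ x ∈ Icc 0 z₀, d x ≤ 0) ∧
      (∀ x ∈ Icc z₀ z₁, 0 ≤ d x) ∧ (∀ x ∈ Icc z₁ M, d x ≤ 0) := by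
  have hint := integrable_comp_of_continuousOn hd hX.aemeasurable hXM
  have hints : Integrable (fun ω => d (X ω) * s (X ω)) μ :=
    integrable_comp_of_continuousOn (hd.mul hs) hX.aemeasurable hXM
  have hsc : ∀ z, ContinuousOn (fun x => d x * (s x - z)) (Icc 0 M) := fun z =>
    hd.mul (hs.sub continuousOn_const)
  have hsi : ∀ z, ∫ ω, d (X ω) * (s (X ω) - z) ∂μ = 0 := by
    intro z
    simp_rw [mul_sub]
    rw [integral_sub hints (hint.mul_const z), integral_mul_const, h0, h1]
    ring
  have hone : ∀ f : ℝ → ℝ, ContinuousOn f (Icc 0 M) → ∫ ω, f (X ω) ∂μ = 0 →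
      (∀ x ∈ Icc 0 M, f x ≤ 0) → ∀ x ∈ Icc 0 M, f x = 0 := fun f hf hfi hle x hx => by
    have := eqOn_zero_of_integral_eq_zero hM hX hXM hF hf.neg
      (fun x hx => by simpa using hle x hx)
      (by simp only [Pi.neg_apply]; rw [integral_neg, hfi, neg_zero]) x hx
    simpa using this
  -- no sign change
  have hno0 : ¬ ∀ x ∈ Icc 0 M, d x ≤ 0 := fun h => by
    obtain ⟨x, hx, hx'⟩ := hne 0 M le_rfl hM le_rfl
    exact hx' (hone d hd h0 h x (Ioo_subset_Icc_self hx))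
  -- a single sign change
  have hno1 : ∀ z ∈ Icc 0 M, ¬ ∀ x ∈ Icc 0 M, d x * (s x - s z) = 0 := fun z hz h => by
    obtain ⟨x, hx, hxz, hx'⟩ : ∃ x ∈ Icc 0 M, x ≠ z ∧ d x ≠ 0 := by
      rcases hz.2.lt_or_eq with h | h
      · obtain ⟨x, hx, hx'⟩ := hne z M hz.1 h le_rfl
        exact ⟨x, ⟨hz.1.trans hx.1.le, hx.2.le⟩, hx.1.ne', hx'⟩
      · obtain ⟨x, hx, hx'⟩ := hne 0 M le_rfl hM le_rfl
        exact ⟨x, Ioo_subset_Icc_self hx, h ▸ hx.2.ne, hx'⟩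
    rcases mul_eq_zero.1 (h x hx) with h' | h'
    · exact hx' h'
    · exact hxz (hmono.injOn hx hz (by linarith))
  set T : Set ℝ := {x | x ∈ Icc 0 M ∧ 0 ≤ d x} with hT
  have hTc : IsCompact T := isCompact_Icc.of_isClosed_subset
    (isClosed_Icc.isClosed_le continuousOn_const hd) fun x hx => hx.1
  have hTn : T.Nonempty := by
    by_contra! h
    refine hno0 fun x hx => ?_
    by_contra! hx'
    exact (h ▸ (⟨hx, hx'.le⟩ : x ∈ T) : x ∈ (∅ : Set ℝ))
  obtain ⟨z₀, ⟨hz₀, hd₀⟩, hmin⟩ := hTc.exists_isLeast hTn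
  obtain ⟨z₁, ⟨hz₁, hd₁⟩, hmax⟩ := hTc.exists_isGreatest hTn
  have hlow : ∀ x, 0 ≤ x → x < z₀ → d x ≤ 0 := fun x hx hxz => by
    by_contra! h
    exact absurd (hmin ⟨⟨hx, by linarith [hz₀.2]⟩, h.le⟩) (not_le.2 hxz)
  have hhigh : ∀ x, z₁ < x → x ≤ M → d x ≤ 0 := fun x hxz hx => by
    by_contra! h
    exact absurd (hmax ⟨⟨by linarith [hz₁.1], hx⟩, h.le⟩) (not_le.2 hxz)
  have hmid : ∀ x ∈ Icc z₀ z₁, 0 ≤ d x := fun x hx => by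
    rcases hx.1.lt_or_eq with h | h
    · rcases hx.2.lt_or_eq with h' | h'
      · exact hord z₀ x z₁ hz₀.1 h h' hz₁.2 hd₀ hd₁
      · rwa [h']
    · rwa [← h]
  have hpos : 0 < z₀ := by
    refine lt_of_le_of_ne hz₀.1 fun h => hno1 z₁ hz₁ (hone _ (hsc _) (hsi _) fun x hx => ?_)
    rcases le_or_gt x z₁ with h' | h'
    · exact mul_nonpos_of_nonneg_of_nonpos (hmid x ⟨h ▸ hx.1, h'⟩)
        (sub_nonpos.2 (hmono.monotoneOn hx hz₁ h'))
    · exact mul_nonpos_of_nonpos_of_nonneg (hhigh x h' hx.2)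
        (sub_nonneg.2 (hmono.monotoneOn hz₁ hx h'.le))
  have hltM : z₁ < M := by
    refine lt_of_le_of_ne hz₁.2 fun h => hno1 z₀ hz₀
      (eqOn_zero_of_integral_eq_zero hM hX hXM hF (hsc _) (fun x hx => ?_) (hsi _))
    rcases lt_or_ge x z₀ with h' | h'
    · exact mul_nonneg_of_nonpos_of_nonpos (hlow x hx.1 h')
        (sub_nonpos.2 (hmono.monotoneOn hx hz₀ h'.le))
    · exact mul_nonneg (hmid x ⟨h', h ▸ hx.2⟩) (sub_nonneg.2 (hmono.monotoneOn hz₀ hx h'))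
  have hlow' : ∀ x ∈ Icc 0 z₀, d x ≤ 0 := by
    rw [← closure_Ico hpos.ne]
    intro x hx
    have hx' : x ∈ Icc 0 M := by
      rw [closure_Ico hpos.ne] at hx
      exact ⟨hx.1, hx.2.trans hz₀.2⟩
    refine ContinuousWithinAt.closure_le hx
      ((hd x hx').mono fun y hy => ⟨hy.1, hy.2.le.trans hz₀.2⟩) continuousWithinAt_const
      fun y hy => hlow y hy.1 hy.2
  have hhigh' : ∀ x ∈ Icc z₁ M, d x ≤ 0 := by
    rw [← closure_Ioc hltM.ne]
    intro x hx
    have hx' : x ∈ Icc 0 M := by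
      rw [closure_Ioc hltM.ne] at hx
      exact ⟨hz₁.1.trans hx.1, hx.2⟩
    refine ContinuousWithinAt.closure_le hx
      ((hd x hx').mono fun y hy => ⟨hz₁.1.trans hy.1.le, hy.2⟩) continuousWithinAt_const
      fun y hy => hhigh y hy.1 hy.2
  refine ⟨z₀, z₁, hpos, ?_, hltM, hlow', hmid, hhigh'⟩
  refine lt_of_le_of_ne (hmin ⟨hz₁, hd₁⟩) fun h => hno0 fun x hx => ?_
  rcases le_total x z₀ with h' | h'
  · exact hlow' x ⟨hx.1, h'⟩
  · exact hhigh' x ⟨h ▸ h', hx.2⟩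

end Crossing

/-! ### Iterated integrals of distribution functions -/

section IteratedIntegrals

variable {Ω : Type*} [MeasurableSpace Ω] {μ : Measure Ω} [IsProbabilityMeasure μ]
  {Z : Ω → ℝ}

theorem integrable_indicator_sub_pow (n : ℕ) (hZ : Measurable Z) {C : ℝ}
    (hC : ∀ᵐ ω ∂μ, C ≤ Z ω) (x : ℝ) :
    Integrable (fun p : ℝ × Ω => (Ici (Z p.2)).indicator (fun y => (y - Z p.2) ^ n) p.1)
      ((volume.restrict (Iic x)).prod μ) := by
  have hb : Integrable (fun p : ℝ × Ω => (Ici C).indicator (fun _ => |x - C| ^ n) p.1)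
      ((volume.restrict (Iic x)).prod μ) := by
    refine Integrable.comp_fst (f := (Ici C).indicator fun _ => |x - C| ^ n) ?_ μ
    rw [integrable_indicator_iff measurableSet_Ici, IntegrableOn,
      Measure.restrict_restrict measurableSet_Ici, Ici_inter_Iic]
    exact integrable_const _
  have hm : Measurable (fun p : ℝ × Ω =>
      (Ici (Z p.2)).indicator (fun y => (y - Z p.2) ^ n) p.1) := by
    have : (fun p : ℝ × Ω => (Ici (Z p.2)).indicator (fun y => (y - Z p.2) ^ n) p.1)
        = {p : ℝ × Ω | Z p.2 ≤ p.1}.indicator (fun p => (p.1 - Z p.2) ^ n) := by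
      ext p; simp [indicator]
    rw [this]
    exact ((measurable_fst.sub (hZ.comp measurable_snd)).pow_const n).indicator
      (measurableSet_le (hZ.comp measurable_snd) measurable_fst)
  refine hb.mono' hm.aestronglyMeasurable ?_
  filter_upwards [Measure.quasiMeasurePreserving_snd.ae hC,
    Measure.quasiMeasurePreserving_fst.ae (ae_restrict_mem (μ := volume) (s := Iic x)
      measurableSet_Iic)] with p h1 h2
  by_cases h : Z p.2 ≤ p.1
  · rw [indicator_of_mem (show p.1 ∈ Ici (Z p.2) from h),
      indicator_of_mem (show p.1 ∈ Ici C from h1.trans h), norm_pow, Real.norm_eq_abs]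
    have h2' : p.1 ≤ x := h2
    refine pow_le_pow_left₀ (abs_nonneg _) (abs_le_abs ?_ ?_) n <;> linarith
  · rw [indicator_of_notMem (show p.1 ∉ Ici (Z p.2) from h), norm_zero]
    exact indicator_nonneg (fun _ _ => by positivity) _

theorem setIntegral_indicator_sub_pow (n : ℕ) (x z : ℝ) :
    ∫ y in Iic x, (Ici z).indicator (fun y => (y - z) ^ n) y
      = max (x - z) 0 ^ (n + 1) / (n + 1) := by
  rw [setIntegral_indicator measurableSet_Ici, Iic_inter_Ici]
  rcases le_total z x with h | h
  · rw [integral_Icc_eq_integral_Ioc, ← intervalIntegral.integral_of_le h,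
      intervalIntegral.integral_comp_sub_right (fun y => y ^ n), integral_pow,
      max_eq_left (sub_nonneg.2 h)]
    simp
  · rw [max_eq_right (by linarith)]
    rcases h.lt_or_eq with h | h
    · simp [Icc_eq_empty h.not_ge]
    · simp [h]

/-- Fubini for the iterated integrals of a distribution function: the inner mean is the distribution
function of `Z` at `y` for `n = 0`, and its integral up to `y` for `n = 1`. -/
theorem setIntegral_integral_indicator_sub_pow (n : ℕ) (hZ : Measurable Z) {C : ℝ}
    (hC : ∀ᵐ ω ∂μ, C ≤ Z ω) (x : ℝ) :
    IntegrableOn (fun y => ∫ ω, (Ici (Z ω)).indicator (fun y => (y - Z ω) ^ n) y ∂μ) (Iic x) ∧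
    ∫ y in Iic x, ∫ ω, (Ici (Z ω)).indicator (fun y => (y - Z ω) ^ n) y ∂μ
      = ∫ ω, max (x - Z ω) 0 ^ (n + 1) / (n + 1) ∂μ := by
  have h := integrable_indicator_sub_pow n hZ hC x
  refine ⟨h.integral_prod_left, ?_⟩
  rw [integral_integral_swap (f := fun y ω =>
    (Ici (Z ω)).indicator (fun y => (y - Z ω) ^ n) y) h]
  simp_rw [setIntegral_indicator_sub_pow]

theorem setIntegral_cdfOf (hZ : Measurable Z) {C : ℝ} (hC : ∀ᵐ ω ∂μ, C ≤ Z ω) (y : ℝ) :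
    IntegrableOn (cdfOf μ Z) (Iic y) ∧
    ∫ z in Iic y, cdfOf μ Z z = ∫ ω, max (y - Z ω) 0 ∂μ := by
  have h := setIntegral_integral_indicator_sub_pow 0 hZ hC y
  have hF : (fun z => ∫ ω, (Ici (Z ω)).indicator (fun y => (y - Z ω) ^ 0) z ∂μ)
      = cdfOf μ Z := by
    ext z
    have : ∀ ω, (Ici (Z ω)).indicator (fun y => (y - Z ω) ^ 0) z
        = {ω | Z ω ≤ z}.indicator (fun _ => (1 : ℝ)) ω := fun ω => by simp [indicator]
    simp_rw [this]
    rw [integral_indicator (measurableSet_le hZ measurable_const)]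
    simp [cdfOf]
  rw [hF] at h
  simpa using h

theorem setIntegral_integral_max (hZ : Measurable Z) {C : ℝ} (hC : ∀ᵐ ω ∂μ, C ≤ Z ω) (x : ℝ) :
    IntegrableOn (fun y => ∫ ω, max (y - Z ω) 0 ∂μ) (Iic x) ∧
    ∫ y in Iic x, ∫ ω, max (y - Z ω) 0 ∂μ = (∫ ω, max (x - Z ω) 0 ^ 2 ∂μ) / 2 := by
  have h := setIntegral_integral_indicator_sub_pow 1 hZ hC x
  have : ∀ y ω, (Ici (Z ω)).indicator (fun y => (y - Z ω) ^ 1) y = max (y - Z ω) 0 := by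
    intro y ω
    by_cases hy : Z ω ≤ y
    · rw [indicator_of_mem (show y ∈ Ici (Z ω) from hy), pow_one, max_eq_left (by linarith)]
    · rw [indicator_of_notMem (show y ∉ Ici (Z ω) from hy), max_eq_right (by linarith)]
  simp_rw [this] at h
  rw [← integral_div]
  norm_num at h
  exact h

/-- Third-degree dominance in terms of second lower partial moments. -/
theorem dominatesTSD_of_lower_partial_moments {Z₁ Z₂ : Ω → ℝ} (h₁ : Measurable Z₁)
    (h₂ : Measurable Z₂) {C : ℝ} (hC₁ : ∀ᵐ ω ∂μ, C ≤ Z₁ ω) (hC₂ : ∀ᵐ ω ∂μ, C ≤ Z₂ ω)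
    (hmean : ∫ ω, Z₂ ω ∂μ ≤ ∫ ω, Z₁ ω ∂μ)
    (h : ∀ x, ∫ ω, max (x - Z₁ ω) 0 ^ 2 ∂μ ≤ ∫ ω, max (x - Z₂ ω) 0 ^ 2 ∂μ) :
    DominatesTSD μ Z₁ Z₂ := by
  refine ⟨hmean, fun x => ?_⟩
  have hin : ∀ y, ∫ z in Iic y, (cdfOf μ Z₂ z - cdfOf μ Z₁ z)
      = ∫ ω, max (y - Z₂ ω) 0 ∂μ - ∫ ω, max (y - Z₁ ω) 0 ∂μ := fun y => by
    rw [integral_sub (setIntegral_cdfOf h₂ hC₂ y).1 (setIntegral_cdfOf h₁ hC₁ y).1,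
      (setIntegral_cdfOf h₂ hC₂ y).2, (setIntegral_cdfOf h₁ hC₁ y).2]
  simp_rw [hin]
  rw [integral_sub (setIntegral_integral_max h₂ hC₂ x).1 (setIntegral_integral_max h₁ hC₁ x).1,
    (setIntegral_integral_max h₂ hC₂ x).2, (setIntegral_integral_max h₁ hC₁ x).2]
  linarith [h x]

end IteratedIntegrals

/-! ### Comparison of the two contracts -/

section Comparison

variable {Ω : Type*} [MeasurableSpace Ω] {μ : Measure Ω} {X : Ω → ℝ}

theorem IsContinuousVersion.riskExposure_ae_eq {I J : ℝ → ℝ} (h : IsContinuousVersion μ X I J) :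
    (fun ω => riskExposure μ X 0 J (X ω)) =ᵐ[μ] fun ω => riskExposure μ X 0 I (X ω) := by
  have hprem : ∫ ω, J (X ω) ∂μ = ∫ ω, I (X ω) ∂μ := integral_congr_ae h.2
  filter_upwards [h.2] with ω hω
  simp only [riskExposure, premium_zero, hprem, hω]

variable [IsProbabilityMeasure μ]

/-- Two increasing exposures with equal first and second moments that cross twice are ordered by
their upper partial moments: up to a quadratic, whose mean is the same for both, the function
`((a + t)⁺)²` is monotone on each of the three ranges between the crossing values, in the
direction that favours `e₁`. -/
theorem integral_max_sq_le_of_two_crossings {M : ℝ} (hX : Measurable X)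
    (hXM : ∀ᵐ ω ∂μ, X ω ∈ Icc 0 M) {e₁ e₂ : ℝ → ℝ} (hc₁ : ContinuousOn e₁ (Icc 0 M))
    (hc₂ : ContinuousOn e₂ (Icc 0 M)) (hm₁ : StrictMonoOn e₁ (Icc 0 M))
    (hm₂ : StrictMonoOn e₂ (Icc 0 M)) (hmean : ∫ ω, e₂ (X ω) ∂μ = ∫ ω, e₁ (X ω) ∂μ)
    (hsq : ∫ ω, e₂ (X ω) ^ 2 ∂μ = ∫ ω, e₁ (X ω) ^ 2 ∂μ) {z₀ z₁ : ℝ} (hz₀ : 0 < z₀)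
    (hz : z₀ < z₁) (hz₁ : z₁ < M) (hlow : ∀ x ∈ Icc 0 z₀, e₂ x ≤ e₁ x)
    (hmid : ∀ x ∈ Icc z₀ z₁, e₁ x ≤ e₂ x) (hhigh : ∀ x ∈ Icc z₁ M, e₂ x ≤ e₁ x) (a : ℝ) :
    ∫ ω, max (a + e₂ (X ω)) 0 ^ 2 ∂μ ≤ ∫ ω, max (a + e₁ (X ω)) 0 ^ 2 ∂μ := by
  have m₀ : z₀ ∈ Icc 0 M := ⟨hz₀.le, (hz.trans hz₁).le⟩
  have m₁ : z₁ ∈ Icc 0 M := ⟨(hz₀.trans hz).le, hz₁.le⟩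
  have heq₀ : e₂ z₀ = e₁ z₀ :=
    le_antisymm (hlow z₀ ⟨hz₀.le, le_rfl⟩) (hmid z₀ ⟨le_rfl, hz.le⟩)
  have heq₁ : e₂ z₁ = e₁ z₁ :=
    le_antisymm (hhigh z₁ ⟨le_rfl, hz₁.le⟩) (hmid z₁ ⟨hz.le, le_rfl⟩)
  obtain ⟨α, β, k1, k2, k3⟩ := exists_quadratic_sub_monotone a (hm₁ m₀ m₁ hz)
  set k : ℝ → ℝ := fun t => max (a + t) 0 ^ 2 - (α * t + β * t ^ 2) with hk
  have hpt : ∀ x ∈ Icc 0 M, k (e₂ x) ≤ k (e₁ x) := by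
    intro x hx
    rcases le_total x z₀ with h | h
    · exact k1 (heq₀ ▸ hm₂.monotoneOn hx m₀ h) (hm₁.monotoneOn hx m₀ h) (hlow x ⟨hx.1, h⟩)
    · rcases le_total x z₁ with h' | h'
      · exact k2 ⟨hm₁.monotoneOn m₀ hx h, hm₁.monotoneOn hx m₁ h'⟩
          ⟨heq₀ ▸ hm₂.monotoneOn m₀ hx h, heq₁ ▸ hm₂.monotoneOn hx m₁ h'⟩ (hmid x ⟨h, h'⟩)
      · exact k3 (heq₁ ▸ hm₂.monotoneOn m₁ hx h') (hm₁.monotoneOn m₁ hx h')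
          (hhigh x ⟨h', hx.2⟩)
  have hint : ∀ e : ℝ → ℝ, ContinuousOn e (Icc 0 M) → ∀ f : ℝ → ℝ, Continuous f →
      Integrable (fun ω => f (e (X ω))) μ := fun e he f hf =>
    integrable_comp_of_continuousOn (f := fun x => f (e x))
      (hf.comp_continuousOn he) hX.aemeasurable hXM
  have hψ : Continuous fun t : ℝ => max (a + t) 0 ^ 2 := by fun_prop
  have hsplit : ∀ e : ℝ → ℝ, ContinuousOn e (Icc 0 M) → ∫ ω, k (e (X ω)) ∂μ
      = ∫ ω, max (a + e (X ω)) 0 ^ 2 ∂μ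
        - (α * ∫ ω, e (X ω) ∂μ + β * ∫ ω, e (X ω) ^ 2 ∂μ) := by
    intro e he
    have i1 : Integrable (fun ω => e (X ω)) μ := hint e he id continuous_id
    have i2 : Integrable (fun ω => e (X ω) ^ 2) μ := hint e he (fun t => t ^ 2) (by fun_prop)
    have i3 : Integrable (fun ω => max (a + e (X ω)) 0 ^ 2) μ := hint e he _ hψ
    simp only [hk]
    have i4 : Integrable (fun ω => α * e (X ω) + β * e (X ω) ^ 2) μ :=
      (i1.const_mul α).add (i2.const_mul β)
    rw [integral_sub i3 i4, integral_add (i1.const_mul α) (i2.const_mul β), integral_const_mul, integral_const_mul]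
  have hkc : Continuous k := by fun_prop
  have hle : ∫ ω, k (e₂ (X ω)) ∂μ ≤ ∫ ω, k (e₁ (X ω)) ∂μ :=
    integral_mono_ae (hint e₂ hc₂ k hkc) (hint e₁ hc₁ k hkc) (hXM.mono fun ω h => hpt _ h)
  rw [hsplit e₁ hc₁, hsplit e₂ hc₂, hmean, hsq] at hle
  linarith

theorem integral_riskExposure {I : ℝ → ℝ} (h : Integrable (fun ω => I (X ω)) μ) :
    ∫ ω, riskExposure μ X 0 I (X ω) ∂μ = 0 := by
  simp only [riskExposure, premium_zero]
  rw [integral_sub h (integrable_const _)]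
  simp

/-- Exposures on `[0, M]` that solve the stationarity equations at two wealth levels and have the
same mean and second moment cross twice. -/
theorem SolvesStationarity.exists_two_crossings {M w₁ w₂ l₁ l₂ c₁ c₂ : ℝ} {D : Set ℝ}
    {U e₁ e₂ : ℝ → ℝ} (hM : 0 < M) (hX : Measurable X) (hXM : ∀ᵐ ω ∂μ, X ω ∈ Icc 0 M)
    (hF : StrictMonoOn (cdfOf μ X) (Ioo 0 M)) (hU : IsUtility D U) (hDAP : StrictlyDAP D U)
    (hw : w₁ < w₂) (hw₂ : w₂ ∈ D) (hl₁ : 0 < l₁) (hl₂ : 0 < l₂)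
    (h₁ : SolvesStationarity D U M w₁ l₁ c₁ e₁) (h₂ : SolvesStationarity D U M w₂ l₂ c₂ e₂)
    (hc₁ : ContinuousOn e₁ (Icc 0 M)) (hc₂ : ContinuousOn e₂ (Icc 0 M))
    (hmean : ∫ ω, e₂ (X ω) ∂μ = ∫ ω, e₁ (X ω) ∂μ)
    (hsq : ∫ ω, e₂ (X ω) ^ 2 ∂μ = ∫ ω, e₁ (X ω) ^ 2 ∂μ) :
    ∃ z₀ z₁, 0 < z₀ ∧ z₀ < z₁ ∧ z₁ < M ∧ (∀ x ∈ Icc 0 z₀, e₂ x ≤ e₁ x) ∧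
      (∀ x ∈ Icc z₀ z₁, e₁ x ≤ e₂ x) ∧ (∀ x ∈ Icc z₁ M, e₂ x ≤ e₁ x) := by
  have hint : ∀ f : ℝ → ℝ, ContinuousOn f (Icc 0 M) → Integrable (fun ω => f (X ω)) μ :=
    fun f hf => integrable_comp_of_continuousOn hf hX.aemeasurable hXM
  have h := _root_.exists_two_crossings hM hX hXM hF (hc₂.sub hc₁) (hc₁.add hc₂)
    ((h₁.strictMonoOn hU hl₁).add (h₂.strictMonoOn hU hl₂))
    (fun a b c ha hab hbc hc hda hdc => sub_nonneg.2 (h₁.le_of_le_of_le hU hDAP hw hw₂ hl₁ hl₂ h₂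
      ha hab hbc hc (sub_nonneg.1 hda) (sub_nonneg.1 hdc)))
    (fun a c ha hac hc => by
      obtain ⟨x, hx, hne⟩ := h₁.exists_ne hU hDAP hw hw₂ hl₁ hl₂ h₂ ha hac hc
      exact ⟨x, hx, sub_ne_zero.2 hne⟩)
    (by
      simp only [Pi.sub_apply]
      rw [integral_sub (hint _ hc₂) (hint _ hc₁), hmean, sub_self])
    (by
      have hs : ∀ ω, (e₂ - e₁) (X ω) * (e₁ + e₂) (X ω) = e₂ (X ω) ^ 2 - e₁ (X ω) ^ 2 :=
        fun ω => by simp only [Pi.sub_apply, Pi.add_apply]; ring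
      simp_rw [hs]
      rw [integral_sub (hint (fun x => e₂ x ^ 2) (hc₂.pow 2))
        (hint (fun x => e₁ x ^ 2) (hc₁.pow 2)), hsq, sub_self])
  simpa only [Pi.sub_apply, sub_nonpos, sub_nonneg] using h

end Comparison

theorem theorem4p1 {Ω : Type*} [MeasurableSpace Ω] (μ : Measure Ω) [IsProbabilityMeasure μ]
    -- the loss: a nonnegative, essentially bounded random variable
    (X : Ω → ℝ) (hX : Measurable X) (hX0 : ∀ᵐ ω ∂μ, 0 ≤ X ω) (hXb : ∃ C : ℝ, ∀ᵐ ω ∂μ, X ω ≤ C)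
    (hF : StrictMonoOn (cdfOf μ X) (Ioo 0 (essSup X μ)))
    -- the variance bound
    (ν : ℝ) (hν : 0 < ν) (hνX : ν < variance X μ)
    -- the utility function and the two initial wealth levels
    (D : Set ℝ) (U : ℝ → ℝ) (hU : IsUtility D U) (hDAP : StrictlyDAP D U)
    (w₁ w₂ : ℝ) (hw : w₁ < w₂)
    -- the utility is defined at all wealth levels that may occur: wealth `w` less a retained
    -- loss in `[0, essSup X]` less the fair premium of an admissible contract
    (hw₂ : w₂ ∈ D)
    (hw₁ : ∀ I : ℝ → ℝ, IsAdmissible μ X 0 ν I →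
      w₁ - essSup X μ - premium μ 0 (fun ω => I (X ω)) ∈ D)
    -- optimal contracts under actuarially fair pricing (zero safety loading)
    (I₁ I₂ : ℝ → ℝ) (hI₁ : IsOptimalContract μ X U w₁ 0 ν I₁)
    (hI₂ : IsOptimalContract μ X U w₂ 0 ν I₂) :
    -- an optimal contract is determined up to null sets; the crossing is that of the
    -- continuous versions, which exist
    (∃ J₁ : ℝ → ℝ, IsContinuousVersion μ X I₁ J₁) ∧
    (∃ J₂ : ℝ → ℝ, IsContinuousVersion μ X I₂ J₂) ∧
    (∀ J₁ J₂ : ℝ → ℝ, IsContinuousVersion μ X I₁ J₁ → IsContinuousVersion μ X I₂ J₂ →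
      UpCrossesTwice (essSup X μ) (riskExposure μ X 0 J₂) (riskExposure μ X 0 J₁)) ∧
    LessDownsideRisk μ (fun ω => -riskExposure μ X 0 I₂ (X ω))
      (fun ω => -riskExposure μ X 0 I₁ (X ω)) := by
  have hXM := ae_mem_Icc_essSup hX0 hXb
  have hM : 0 < essSup X μ := by
    by_contra! hM
    have h0 : X =ᵐ[μ] 0 := hXM.mono fun ω h => le_antisymm (h.2.trans hM) h.1
    rw [variance_congr h0, variance_zero] at hνX
    linarith
  simp only [premium_zero] at hw₁
  have hzero : IsAdmissible μ X 0 ν (fun _ => 0) := by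
    refine ⟨IsIndemnity.zero, ?_⟩
    rw [variance_riskExposure (I := fun _ => 0) measurable_const]
    exact (variance_zero μ).trans_le hν.le
  have hD₁ : WealthInDomain μ X ν D w₁ :=
    ⟨hU.ordConnected.out (hw₁ _ hzero) hw₂ ⟨by simpa using hM.le, hw.le⟩, hw₁⟩
  have hD₂ : WealthInDomain μ X ν D w₂ := ⟨hw₂, fun I hI =>
    hU.ordConnected.out (hw₁ I hI) hw₂
      ⟨by linarith, by linarith [hI.1.integral_nonneg (X := X) hXM]⟩⟩
  obtain ⟨hv₁, l₁, c₁, hl₁, hs₁⟩ := hI₁.exists_stationary hX hXM hν hνX hU hD₁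
  obtain ⟨hv₂, l₂, c₂, hl₂, hs₂⟩ := hI₂.exists_stationary hX hXM hν hνX hU hD₂
  have hm₁ := hI₁.1.1.measurable_comp hX
  have hm₂ := hI₂.1.1.measurable_comp hX
  have hmean₁ := integral_riskExposure (hI₁.1.1.integrable hX hXM)
  have hmean₂ := integral_riskExposure (hI₂.1.1.integrable hX hXM)
  have he₁ : Measurable fun ω => riskExposure μ X 0 I₁ (X ω) := hm₁.sub_const _
  have he₂ : Measurable fun ω => riskExposure μ X 0 I₂ (X ω) := hm₂.sub_const _
  have hsq₁ : ∫ ω, riskExposure μ X 0 I₁ (X ω) ^ 2 ∂μ = ν := by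
    rw [← variance_of_integral_eq_zero he₁.aemeasurable hmean₁, variance_riskExposure hm₁, hv₁]
  have hsq₂ : ∫ ω, riskExposure μ X 0 I₂ (X ω) ^ 2 ∂μ = ν := by
    rw [← variance_of_integral_eq_zero he₂.aemeasurable hmean₂, variance_riskExposure hm₂, hv₂]
  -- the facts shared by all continuous versions
  have hversion : ∀ J₁ J₂ : ℝ → ℝ, IsContinuousVersion μ X I₁ J₁ →
      IsContinuousVersion μ X I₂ J₂ →
      (∃ z₀ z₁, 0 < z₀ ∧ z₀ < z₁ ∧ z₁ < essSup X μ ∧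
        (∀ x ∈ Icc 0 z₀, riskExposure μ X 0 J₂ x ≤ riskExposure μ X 0 J₁ x) ∧
        (∀ x ∈ Icc z₀ z₁, riskExposure μ X 0 J₁ x ≤ riskExposure μ X 0 J₂ x) ∧
        (∀ x ∈ Icc z₁ (essSup X μ), riskExposure μ X 0 J₂ x ≤ riskExposure μ X 0 J₁ x)) ∧
      ∀ a, ∫ ω, max (a + riskExposure μ X 0 I₂ (X ω)) 0 ^ 2 ∂μ
        ≤ ∫ ω, max (a + riskExposure μ X 0 I₁ (X ω)) 0 ^ 2 ∂μ := by
    intro J₁ J₂ hJ₁ hJ₂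
    have hS₁ : SolvesStationarity D U (essSup X μ) w₁ l₁ c₁ (riskExposure μ X 0 J₁) :=
      hJ₁.stationary hXM hM hF hU hD₁ hI₁.1 hs₁
    have hS₂ : SolvesStationarity D U (essSup X μ) w₂ l₂ c₂ (riskExposure μ X 0 J₂) :=
      hJ₂.stationary hXM hM hF hU hD₂ hI₂.1 hs₂
    have hc₁ : ContinuousOn (riskExposure μ X 0 J₁) (Icc 0 (essSup X μ)) :=
      hJ₁.1.sub continuousOn_const
    have hc₂ : ContinuousOn (riskExposure μ X 0 J₂) (Icc 0 (essSup X μ)) :=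
      hJ₂.1.sub continuousOn_const
    have hmove₁ : ∀ f : ℝ → ℝ, ∫ ω, f (riskExposure μ X 0 J₁ (X ω)) ∂μ
        = ∫ ω, f (riskExposure μ X 0 I₁ (X ω)) ∂μ := fun f =>
      integral_congr_ae (hJ₁.riskExposure_ae_eq.mono fun ω h => congrArg f h)
    have hmove₂ : ∀ f : ℝ → ℝ, ∫ ω, f (riskExposure μ X 0 J₂ (X ω)) ∂μ
        = ∫ ω, f (riskExposure μ X 0 I₂ (X ω)) ∂μ := fun f =>
      integral_congr_ae (hJ₂.riskExposure_ae_eq.mono fun ω h => congrArg f h)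
    have hmean : ∫ ω, riskExposure μ X 0 J₂ (X ω) ∂μ = ∫ ω, riskExposure μ X 0 J₁ (X ω) ∂μ := by
      rw [hmove₁ fun t => t, hmove₂ fun t => t, hmean₁, hmean₂]
    have hsq : ∫ ω, riskExposure μ X 0 J₂ (X ω) ^ 2 ∂μ
        = ∫ ω, riskExposure μ X 0 J₁ (X ω) ^ 2 ∂μ := by
      rw [hmove₁ fun t => t ^ 2, hmove₂ fun t => t ^ 2, hsq₁, hsq₂]
    have hcross := hS₁.exists_two_crossings hM hX hXM hF hU hDAP hw hw₂ hl₁ hl₂ hS₂ hc₁ hc₂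
      hmean hsq
    refine ⟨hcross, fun a => ?_⟩
    obtain ⟨z₀, z₁, p₀, p₁, p₂, q₀, q₁, q₂⟩ := hcross
    rw [← hmove₁ fun t => max (a + t) 0 ^ 2, ← hmove₂ fun t => max (a + t) 0 ^ 2]
    exact integral_max_sq_le_of_two_crossings hX hXM hc₁ hc₂ (hS₁.strictMonoOn hU hl₁)
      (hS₂.strictMonoOn hU hl₂) hmean hsq p₀ p₁ p₂ q₀ q₁ q₂ a
  obtain ⟨J₁, hJ₁⟩ := exists_isContinuousVersion hXM hU hD₁ hI₁.1 hl₁ hs₁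
  obtain ⟨J₂, hJ₂⟩ := exists_isContinuousVersion hXM hU hD₂ hI₂.1 hl₂ hs₂
  refine ⟨⟨J₁, hJ₁⟩, ⟨J₂, hJ₂⟩, fun J₁ J₂ hJ₁ hJ₂ => ?_, ?_, ?_, ?_⟩
  · obtain ⟨z₀, z₁, p₀, p₁, p₂, q₀, q₁, q₂⟩ := (hversion J₁ J₂ hJ₁ hJ₂).1
    exact ⟨z₀, z₁, p₀, p₁, p₂, fun x h h' => q₀ x ⟨h, h'.le⟩, fun x h h' => q₁ x ⟨h, h'.le⟩,
      fun x h h' => q₂ x ⟨h, h'⟩⟩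
  · -- an exposure is at most `M`, so that `-M` bounds the profits from below
    have hbound : ∀ I, IsIndemnity (essSup X μ) I →
        ∀ᵐ ω ∂μ, -essSup X μ ≤ -riskExposure μ X 0 I (X ω) := fun I hI => by
      have h0 := hI.integral_nonneg (X := X) hXM
      filter_upwards [hI.ae_mem_Icc hXM] with ω h
      simp only [riskExposure, premium_zero]
      linarith [h.2]
    refine dominatesTSD_of_lower_partial_moments he₂.neg he₁.neg (hbound _ hI₂.1.1)
      (hbound _ hI₁.1.1) (by rw [integral_neg, integral_neg, hmean₁, hmean₂]) fun a => ?_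
    simpa only [sub_neg_eq_add] using (hversion J₁ J₂ hJ₁ hJ₂).2 a
  · rw [integral_neg, integral_neg, hmean₁, hmean₂]
  · rw [variance_fun_neg, variance_fun_neg, variance_riskExposure hm₁, variance_riskExposure hm₂,
      hv₁, hv₂]
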